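/- **Setting.** A hyperkähler structure on a smooth manifold $M$ is a Riemannian metric $g$ with complex structures $I_1,I_2,I_3$, $I_1I_2I_3=-1$, such that each $(g,I_i)$ is Kähler with Kähler form $\omega_i(X,Y)=g(I_iX,Y)$. For an almost complex structure $J$ put $d^c_Jf=-df\circ J$, so that $dd^c_J=2i\partial\bar\partial_J$. A Kähler potential of $g$ with respect to $J$ is a smooth function $K$ with $\tfrac12dd^c_JK=g(J\cdot,\cdot)$. Inequalities between real $(1,1)$-forms $\beta\le\gamma$ for $J$ mean $\beta(X,JX)\le\gamma(X,JX)$ for all tangent vectors $X$, and $\gamma>0$ means $\gamma(X,JX)>0$ for all $X\neq0$; a smooth function $f$ is strictly plurisubharmonic for $J$ if $dd^c_Jf>0$. Let $\mathbb R$ act smoothly on $M$, preserving the hyperkähler structure, with generator $T$ (which may have zeros) and hyperkähler moment map $x=(x_1,x_2,x_3)$, $dx_i=-\iota_T\omega_i$. For $a>0$ let $(g_a,I_1^a,I_2^a,I_3^a)$ be the Taub-NUT deformation: the hyperkähler quotient of $M\times\mathbb H$ by the $\mathbb R$-action generated by $aT+\partial/\partial q_0$, identified with $M$ through the map $m\mapsto(m,0,ax_1(m)-\lambda_1,ax_2(m)-\lambda_2,ax_3(m)-\lambda_3)$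 into a level set of the moment map of this action. Explicitly, with $\theta=g(T,\cdot)$, $$g_a=g+a^2\sum_{i=1}^3dx_i^2-\frac{a^2}{1+a^2|T|_g^2}\theta^2,\qquad I_i^a=I_i-\frac{a^2}{1+a^2|T|_g^2}\,\theta\otimes I_iT+a^2dx_i\otimes T.$$ **(A)** Let $(i,j,k)$ be a cyclic permutation of $(1,2,3)$, let $K_i$ be an $\mathbb R$-invariant Kähler potential of $g$ with respect to $I_i$, and suppose that $d^c_{I_i}K_i(T)=2x_i$. Then for every $a>0$ the function $K_i^a=K_i+\frac{a^2}{2}(x_i^2+|x|^2)$ is an $\mathbb R$-invariant Kähler potential of $g_a$ with respect to $I_i^a$, and $$d^c_{I_i^a}K_i^a=d^c_{I_i}K_i+a^2(x_jdx_k-x_kdx_j).$$ **(B)** Let $S$ be a compact manifold with a Riemannian metric $g_S$, let $M=C(S)=\mathbb R_+\times S$ be its cone with metric $g_0=d\rho^2+\rho^2g_S$, and suppose that $(M,g_0)$ carries a hyperkähler structure $(g_0,I_1,I_2,I_3)$. Let $\mathbb R$ act smoothly on $S$ so that the extended action $t\cdot(\rho,s)=(\rho,t\cdot s)$ preserves this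 hyperkähler structure; let $T$ be its generator on $M$ and $x_j=\frac14d^c_{I_j}(\rho^2)(T)$, $j=1,2,3$. For $a>0$ let $(g_a,I_i^a)$ be the Taub-NUT deformation of $M$ formed with these moment maps, and let $$K_1^a=\tfrac12\rho^2+a^2x_1^2+\tfrac{a^2}{2}(x_2^2+x_3^2).$$ Then: 1. For every $a>0$, $K_1^a$ is an $\mathbb R$-invariant Kähler potential of $g_a$ with respect to $I_1^a$. 2. There is a constant $C>0$, independent of $a$, such that $dK_1^a\wedge d^c_{I_1^a}K_1^a\le C\,K_1^a\,dd^c_{I_1^a}K_1^a$ for all $a>0$. 3. There is $0<\alpha_0<1$, independent of $a$, such that for all $a>0$ and all $\alpha>\alpha_0$ the function $(K_1^a)^\alpha$ is smooth and strictly plurisubharmonic for $I_1^a$, that is, $dd^c_{I_1^a}(K_1^a)^\alpha>0$. -/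

import Mathlib

open scoped ContDiff Manifold Quaternion

noncomputable section

namespace TaubNUT

/-! ### Differential forms of low degree on a manifold -/

section Forms

variable {E : Type*} [NormedAddCommGroup E] [NormedSpace ℝ E]
  {H : Type*} [TopologicalSpace H] (I : ModelWithCorners ℝ E H)
  {M : Type*} [TopologicalSpace M] [ChartedSpace H M]

/-- The differential `df` of a real function, as a `1`-form. -/
def dFun (f : M → ℝ) (m : M) : TangentSpace I m →L[ℝ] ℝ :=
  mfderiv I 𝓘(ℝ, ℝ) f m

/-- The vector field around `m` that has constant coordinates `v` in the preferred chart at `m`,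
parametrised by the coordinates `y`: it is the image of `v` under the derivative at `y` of the
inverse of the chart. -/
def chartField (m : M) (v : E) (y : E) : TangentSpace I ((extChartAt I m).symm y) :=
  mfderivWithin 𝓘(ℝ, E) I (extChartAt I m).symm (Set.range I) y v

/-- The coordinates of the tangent vector `X` at `m` in the preferred chart at `m`. -/
def chartCoord (m : M) (X : TangentSpace I m) : E :=
  mfderiv I 𝓘(ℝ, E) (extChartAt I m) m X

/-- The exterior derivative of a `1`-form, computed in the preferred chart at `m`:
`dα(X, Y) = X(α(Y)) - Y(α(X))` for the extensions of `X` and `Y` with constant coordinates. -/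
def dOne (α : ∀ m : M, TangentSpace I m →L[ℝ] ℝ) (m : M) (X Y : TangentSpace I m) : ℝ :=
  fderivWithin ℝ (fun y => α ((extChartAt I m).symm y) (chartField I m (chartCoord I m Y) y))
      (Set.range I) (extChartAt I m m) (chartCoord I m X)
    - fderivWithin ℝ
      (fun y => α ((extChartAt I m).symm y) (chartField I m (chartCoord I m X) y))
      (Set.range I) (extChartAt I m m) (chartCoord I m Y)

/-- For extensions of `Y`, `Z` with constant coordinates, the derivative `X(Ω(Y, Z))` at `m`. -/
def derivTwo (Ω : ∀ m : M, TangentSpace I m →L[ℝ] TangentSpace I m →L[ℝ] ℝ) (m : M)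
    (X Y Z : TangentSpace I m) : ℝ :=
  fderivWithin ℝ
    (fun y => Ω ((extChartAt I m).symm y) (chartField I m (chartCoord I m Y) y)
      (chartField I m (chartCoord I m Z) y))
    (Set.range I) (extChartAt I m m) (chartCoord I m X)

/-- The exterior derivative of a `2`-form:
`dΩ(X, Y, Z) = X(Ω(Y, Z)) + Y(Ω(Z, X)) + Z(Ω(X, Y))` for the extensions with constant
coordinates. -/
def dTwo (Ω : ∀ m : M, TangentSpace I m →L[ℝ] TangentSpace I m →L[ℝ] ℝ) (m : M)
    (X Y Z : TangentSpace I m) : ℝ :=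
  derivTwo I Ω m X Y Z + derivTwo I Ω m Y Z X + derivTwo I Ω m Z X Y

/-- The wedge product of two `1`-forms. -/
def wedge (α β : ∀ m : M, TangentSpace I m →L[ℝ] ℝ) (m : M) (X Y : TangentSpace I m) : ℝ :=
  α m X * β m Y - α m Y * β m X

/-- `d^c_J f = J ∘ df`, where `J` acts on `1`-forms by `(Jα)(X) = -α(JX)`. -/
def dc (J : ∀ m : M, TangentSpace I m →L[ℝ] TangentSpace I m) (f : M → ℝ) (m : M) :
    TangentSpace I m →L[ℝ] ℝ :=
  -((dFun I f m).comp (J m))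

/-- The `2`-form `dd^c_J f = 2i ∂∂̄ f`. -/
def ddc (J : ∀ m : M, TangentSpace I m →L[ℝ] TangentSpace I m) (f : M → ℝ) (m : M)
    (X Y : TangentSpace I m) : ℝ :=
  dOne I (dc I J f) m X Y

/-- `K` is a Kähler potential of `g` with respect to `J`: it is smooth and `½ dd^c_J K = ω`,
where `ω(X, Y) = g(JX, Y)`. -/
def IsKahlerPotential (g : ∀ m : M, TangentSpace I m → TangentSpace I m → ℝ)
    (J : ∀ m : M, TangentSpace I m →L[ℝ] TangentSpace I m) (K : M → ℝ) : Prop :=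
  ContMDiff I 𝓘(ℝ, ℝ) ∞ K ∧
    ∀ (m : M) (X Y : TangentSpace I m), (1 / 2 : ℝ) * ddc I J K m X Y = g m (J m X) Y

/-- The inequality `β ≤ γ` of real `(1,1)`-forms for `J`. -/
def FormLE (J : ∀ m : M, TangentSpace I m →L[ℝ] TangentSpace I m)
    (β γ : ∀ m : M, TangentSpace I m → TangentSpace I m → ℝ) : Prop :=
  ∀ (m : M) (X : TangentSpace I m), β m X (J m X) ≤ γ m X (J m X)

/-- A smooth function `f` is strictly plurisubharmonic for `J` if `dd^c_J f > 0`. -/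
def StrictlyPSH (J : ∀ m : M, TangentSpace I m →L[ℝ] TangentSpace I m) (f : M → ℝ) : Prop :=
  ContMDiff I 𝓘(ℝ, ℝ) ∞ f ∧
    ∀ (m : M) (X : TangentSpace I m), X ≠ 0 → 0 < ddc I J f m X (J m X)

/-- The Nijenhuis tensor of `J` vanishes. -/
def IsIntegrable [IsManifold I ∞ M]
    (J : ∀ m : M, TangentSpace I m →L[ℝ] TangentSpace I m) : Prop :=
  ∀ (m : M) (X Y : ∀ p : M, TangentSpace I p),
    ContMDiffAt I I.tangent ∞ (fun p => (⟨p, X p⟩ : TangentBundle I M)) m →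
    ContMDiffAt I I.tangent ∞ (fun p => (⟨p, Y p⟩ : TangentBundle I M)) m →
      VectorField.mlieBracket I (fun p => J p (X p)) (fun p => J p (Y p)) m
        - J m (VectorField.mlieBracket I (fun p => J p (X p)) Y m)
        - J m (VectorField.mlieBracket I X (fun p => J p (Y p)) m)
        - VectorField.mlieBracket I X Y m = 0

end Forms

/-! ### Hyperkähler structures and `ℝ`-actions -/

section Hyperkahler

variable {E : Type*} [NormedAddCommGroup E] [NormedSpace ℝ E]
  {H : Type*} [TopologicalSpace H] (I : ModelWithCorners ℝ E H)
  (M : Type*) [TopologicalSpace M] [ChartedSpace H M] [IsManifold I ∞ M]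

/-- A smooth Riemannian metric on `M`. -/
abbrev SmoothMetric :=
  Bundle.ContMDiffRiemannianMetric I ∞ E (fun m : M => TangentSpace I m)

/-- A hyperkähler structure `(g, I₁, I₂, I₃)`: each `(g, I_i)` is Kähler, with Kähler form
`ω_i(X, Y) = g(I_i X, Y)`, and `I₁ I₂ I₃ = -1`. The indices `1, 2, 3` are `0, 1, 2 : Fin 3`. -/
structure Hyperkahler where
  g : SmoothMetric I M
  J : Fin 3 → ∀ m : M, TangentSpace I m →L[ℝ] TangentSpace I m
  smooth_J : ∀ i, ContMDiff I (I.prod 𝓘(ℝ, E →L[ℝ] E)) ∞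
    (fun m => Bundle.TotalSpace.mk' (E →L[ℝ] E)
      (E := fun m : M => TangentSpace I m →L[ℝ] TangentSpace I m) m (J i m))
  J_sq : ∀ i m X, J i m (J i m X) = -X
  J_mul : ∀ m X, J 0 m (J 1 m (J 2 m X)) = -X
  J_isometry : ∀ i m X Y, g.inner m (J i m X) (J i m Y) = g.inner m X Y
  integrable : ∀ i, IsIntegrable I (J i)
  closed : ∀ i m X Y Z, dTwo I (fun p => (g.inner p).comp (J i p)) m X Y Z = 0

/-- A smooth action of the group `ℝ` on `M`. -/
structure RAction where
  act : ℝ → M → M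
  zero_act : ∀ m, act 0 m = m
  add_act : ∀ s t m, act (s + t) m = act s (act t m)
  smooth : ContMDiff (𝓘(ℝ, ℝ).prod I) I ∞ (fun p : ℝ × M => act p.1 p.2)

variable {I M}

/-- The metric of a hyperkähler structure as a function. -/
def Hyperkahler.metric (hk : Hyperkahler I M) (m : M) (X Y : TangentSpace I m) : ℝ :=
  hk.g.inner m X Y

/-- The Kähler form `ω_i(X, Y) = g(I_i X, Y)`. -/
def Hyperkahler.omega (hk : Hyperkahler I M) (i : Fin 3) (m : M) (X Y : TangentSpace I m) : ℝ :=
  hk.g.inner m (hk.J i m X) Y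

/-- The generator `T` of an `ℝ`-action: the velocity at time `0` of the orbits (note that
`act 0 m = m`). -/
def RAction.gen (A : RAction I M) (m : M) : TangentSpace I m :=
  mfderiv 𝓘(ℝ, ℝ) I (fun t : ℝ => A.act t m) 0 (1 : ℝ)

/-- A function is invariant under the action. -/
def RAction.Invariant (A : RAction I M) (f : M → ℝ) : Prop :=
  ∀ t m, f (A.act t m) = f m

/-- The action preserves the metric and the three complex structures. -/
def RAction.Preserves (A : RAction I M) (hk : Hyperkahler I M) : Prop :=
  ∀ (t : ℝ) (m : M) (X : TangentSpace I m),
    (∀ Y : TangentSpace I m,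
      hk.g.inner (A.act t m) (mfderiv I I (A.act t) m X) (mfderiv I I (A.act t) m Y)
        = hk.g.inner m X Y) ∧
    ∀ i, hk.J i (A.act t m) (mfderiv I I (A.act t) m X) = mfderiv I I (A.act t) m (hk.J i m X)

/-- `x = (x₁, x₂, x₃)` is a hyperkähler moment map of the action: `dx_i = -ι_T ω_i`. -/
def IsMomentMap (hk : Hyperkahler I M) (A : RAction I M) (x : Fin 3 → M → ℝ) : Prop :=
  ∀ i, ContMDiff I 𝓘(ℝ, ℝ) ∞ (x i) ∧
    ∀ (m : M) (X : TangentSpace I m), dFun I (x i) m X = -hk.omega i m (A.gen m) X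

/-! ### The Taub-NUT deformation

It is the hyperkähler quotient of `M × ℍ` by the free `ℝ`-action generated by
`Z = aT + ∂/∂q₀`, whose moment map is `(m, q) ↦ (a x_i(m) - q_i)`. A level set
`{q_i = a x_i(m) - λ_i}` meets the slice `q₀ = 0` in the image of
`σ(m) = (m, 0, a x_i(m) - λ_i)`, which meets every orbit once; so `σ` identifies `M` with the
quotient, and the quotient structure is transported to `M` below. Tangent vectors of `M × ℍ` at
`σ(m)` are pairs in `T_m M × ℍ`. -/

/-- The imaginary units `i, j, k`. -/
def imUnit : Fin 3 → ℍ[ℝ] := ![⟨0, 1, 0, 0⟩, ⟨0, 0, 1, 0⟩, ⟨0, 0, 0, 1⟩]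

section Deformation

variable (hk : Hyperkahler I M) (A : RAction I M) (x : Fin 3 → M → ℝ) (a : ℝ)

/-- The product metric `g + g_ℍ` on `M × ℍ`. -/
def prodMetric (m : M) (v : TangentSpace I m × ℍ[ℝ]) : TangentSpace I m × ℍ[ℝ] →L[ℝ] ℝ :=
  (hk.g.inner m v.1).comp (ContinuousLinearMap.fst ℝ (TangentSpace I m) ℍ[ℝ])
    + (innerSL ℝ v.2).comp (ContinuousLinearMap.snd ℝ (TangentSpace I m) ℍ[ℝ])

/-- The product complex structure `I_i` on `M × ℍ`, acting on `ℍ` by left multiplication by the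
`i`-th imaginary unit. -/
def prodJ (i : Fin 3) (m : M) :
    TangentSpace I m × ℍ[ℝ] →L[ℝ] TangentSpace I m × ℍ[ℝ] :=
  (hk.J i m).prodMap (ContinuousLinearMap.mul ℝ ℍ[ℝ] (imUnit i))

/-- The generator `Z = aT + ∂/∂q₀`. -/
def prodGen (m : M) : TangentSpace I m × ℍ[ℝ] := (a • A.gen m, 1)

/-- The differential `dσ(X) = (X, 0, a dx₁(X), a dx₂(X), a dx₃(X))`. -/
def dSlice (m : M) : TangentSpace I m →L[ℝ] TangentSpace I m × ℍ[ℝ] :=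
  (ContinuousLinearMap.id ℝ (TangentSpace I m)).prod
    (∑ i, (a • dFun I (x i) m).smulRight (imUnit i))

/-- The horizontal lift of `X ∈ T_m M`: the component of `dσ(X)` orthogonal to `Z`. -/
def horLift (m : M) : TangentSpace I m →L[ℝ] TangentSpace I m × ℍ[ℝ] :=
  dSlice x a m
    - ((prodMetric hk m (prodGen A a m) (prodGen A a m))⁻¹ •
        (prodMetric hk m (prodGen A a m)).comp (dSlice x a m)).smulRight (prodGen A a m)

/-- The differential at `σ(m)` of the projection of the level set to the quotient `M`: on
vectors tangent to the level set, this is the map with kernel `ℝ Z` and with `dσ(X) ↦ X`. -/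
def dProj (m : M) : TangentSpace I m × ℍ[ℝ] →L[ℝ] TangentSpace I m :=
  ContinuousLinearMap.fst ℝ (TangentSpace I m) ℍ[ℝ]
    - ((innerSL ℝ (1 : ℍ[ℝ])).comp
        (ContinuousLinearMap.snd ℝ (TangentSpace I m) ℍ[ℝ])).smulRight (a • A.gen m)

/-- The deformed metric `g_a`: the product metric on horizontal lifts. -/
def deformedMetric (m : M) (X Y : TangentSpace I m) : ℝ :=
  prodMetric hk m (horLift hk A x a m X) (horLift hk A x a m Y)

/-- The deformed complex structure `I_i^a`: the product complex structure on horizontal lifts,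
projected to the quotient. -/
def deformedJ (i : Fin 3) (m : M) : TangentSpace I m →L[ℝ] TangentSpace I m :=
  (dProj A a m).comp ((prodJ hk i m).comp (horLift hk A x a m))

/-- The deformed potential `K_i^a = K + (a²/2)(x_i² + |x|²)`. -/
def deformedPotential (i : Fin 3) (K : M → ℝ) (m : M) : ℝ :=
  K m + a ^ 2 / 2 * (x i m ^ 2 + ∑ j, x j m ^ 2)

end Deformation

end Hyperkahler

/-! ### Riemannian cones -/

section Cone

variable {E : Type*} [NormedAddCommGroup E] [NormedSpace ℝ E]
  {H : Type*} [TopologicalSpace H] {I : ModelWithCorners ℝ E H}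
  {S : Type*} [TopologicalSpace S] [ChartedSpace H S]

/-- The half-line `ℝ₊ = (0, ∞)`. -/
abbrev PosReal : TopologicalSpace.Opens ℝ := ⟨Set.Ioi 0, isOpen_Ioi⟩

/-- The cone `C(S) = ℝ₊ × S`. -/
abbrev Cone (S : Type*) : Type _ := PosReal × S

/-- The model with corners of the cone. -/
abbrev coneModel (I : ModelWithCorners ℝ E H) : ModelWithCorners ℝ (ℝ × E) (ModelProd ℝ H) :=
  𝓘(ℝ, ℝ).prod I

/-- The radius function. -/
def radius (p : Cone S) : ℝ := (p.1 : ℝ)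

/-- `g` is the cone metric `dρ² + ρ² g_S`. -/
def IsConeMetric [IsManifold I ∞ S] (gS : SmoothMetric I S)
    (g : SmoothMetric (coneModel I) (Cone S)) : Prop :=
  ∀ (p : Cone S) (X Y : TangentSpace (coneModel I) p),
    g.inner p X Y = dFun (coneModel I) radius p X * dFun (coneModel I) radius p Y
      + radius p ^ 2 * gS.inner p.2 (mfderiv (coneModel I) I Prod.snd p X)
          (mfderiv (coneModel I) I Prod.snd p Y)

/-- The extension `t · (ρ, s) = (ρ, t · s)` to the cone of an `ℝ`-action on `S`. -/
def RAction.cone (A : RAction I S) : RAction (coneModel I) (Cone S) where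
  act t p := (p.1, A.act t p.2)
  zero_act p := by simp [A.zero_act]
  add_act s t p := by simp [A.add_act]
  smooth := by
    refine ContMDiff.prodMk (contMDiff_fst.comp contMDiff_snd) ?_
    exact A.smooth.comp (contMDiff_fst.prodMk (contMDiff_snd.comp contMDiff_snd))

/-- The homogeneous moment maps `x_j = ¼ d^c_{I_j}(ρ²)(T)` on a hyperkähler cone. -/
def coneMoment [IsManifold I ∞ S] (hk : Hyperkahler (coneModel I) (Cone S))
    (A : RAction I S) (j : Fin 3) (p : Cone S) : ℝ :=
  (1 / 4 : ℝ) * dc (coneModel I) (hk.J j) (fun q => radius q ^ 2) p (A.cone.gen p)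

/-- The function `½ρ² + a² x₁² + (a²/2)(x₂² + x₃²)`. -/
def conePotential [IsManifold I ∞ S] (hk : Hyperkahler (coneModel I) (Cone S))
    (A : RAction I S) (a : ℝ) (p : Cone S) : ℝ :=
  (1 / 2 : ℝ) * radius p ^ 2 + a ^ 2 * coneMoment hk A 0 p ^ 2
    + a ^ 2 / 2 * (coneMoment hk A 1 p ^ 2 + coneMoment hk A 2 p ^ 2)

end Cone

end TaubNUT

end

noncomputable section

namespace TaubNUT

section Charts

variable {E : Type*} [NormedAddCommGroup E] [NormedSpace ℝ E]
  {H : Type*} [TopologicalSpace H] (I : ModelWithCorners ℝ E H)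
  {M : Type*} [TopologicalSpace M] [ChartedSpace H M]

theorem chartCoord_eq [IsManifold I 1 M] (m : M) (X : TangentSpace I m) :
    chartCoord I m X = X := by
  unfold chartCoord
  rw [mfderiv_extChartAt_self]
  rfl

theorem chartField_self [IsManifold I 1 M] (m : M) (v : E) :
    chartField I m v (extChartAt I m m) = v := by
  unfold chartField
  rw [mfderivWithin_range_extChartAt_symm]
  rfl

/-- Evaluating a fibrewise quantity on coordinate fields at the centre of the chart. -/
theorem eval_chartField_self [IsManifold I 1 M] {β : Type*} (m : M)
    (α : ∀ p : M, TangentSpace I p → β) (X : TangentSpace I m) :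
    α ((extChartAt I m).symm (extChartAt I m m)) (chartField I m X (extChartAt I m m)) = α m X := by
  have key : ∀ (p : M) (_ : p = m) (w : TangentSpace I p), (w : E) = X → α p w = α m X := by
    rintro p rfl w h
    exact congrArg (α p) h
  exact key _ (extChartAt_to_inv m) _ (chartField_self I m X)

theorem eval_chartField_self₂ [IsManifold I 1 M] {β : Type*} (m : M)
    (α : ∀ p : M, TangentSpace I p → TangentSpace I p → β) (X Y : TangentSpace I m) :
    α ((extChartAt I m).symm (extChartAt I m m)) (chartField I m X (extChartAt I m m))
      (chartField I m Y (extChartAt I m m)) = α m X Y := by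
  have key : ∀ (p : M) (_ : p = m) (w w' : TangentSpace I p), (w : E) = X → (w' : E) = Y →
      α p w w' = α m X Y := by
    rintro p rfl w w' h h'
    exact congrArg₂ (α p) h h'
  exact key _ (extChartAt_to_inv m) _ _ (chartField_self I m X) (chartField_self I m Y)

/-- The components of a `1`-form in the preferred chart at `m`. -/
def coordForm (α : ∀ m : M, TangentSpace I m →L[ℝ] ℝ) (m : M) (v : E) (y : E) : ℝ :=
  α ((extChartAt I m).symm y) (chartField I m v y)

theorem dOne_eq [I.Boundaryless] [IsManifold I 1 M] (α : ∀ m : M, TangentSpace I m →L[ℝ] ℝ)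
    (m : M) (X Y : E) :
    dOne I α m X Y = fderiv ℝ (coordForm I α m Y) (extChartAt I m m) X
      - fderiv ℝ (coordForm I α m X) (extChartAt I m m) Y := by
  have h : ∀ Z : E, chartCoord I m Z = Z := fun Z => chartCoord_eq I m Z
  unfold dOne
  rw [h, h, I.range_eq_univ, fderivWithin_univ, fderivWithin_univ]
  rfl

/-- A function read in the preferred chart at `m`. -/
def coordFun (f : M → ℝ) (m : M) (y : E) : ℝ := f ((extChartAt I m).symm y)

theorem mdifferentiableAt_chart_symm [I.Boundaryless] [IsManifold I 1 M] (m : M) {y : E}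
    (hy : y ∈ (extChartAt I m).target) :
    MDifferentiableAt 𝓘(ℝ, E) I (extChartAt I m).symm y := by
  have := mdifferentiableWithinAt_extChartAt_symm (I := I) hy
  rwa [I.range_eq_univ, mdifferentiableWithinAt_univ] at this

theorem chartField_eq [I.Boundaryless] (m : M) (v y : E) :
    chartField I m v y = mfderiv 𝓘(ℝ, E) I (extChartAt I m).symm y v := by
  unfold chartField
  rw [I.range_eq_univ, mfderivWithin_univ]

theorem dFun_chartField [I.Boundaryless] [IsManifold I 1 M] {f : M → ℝ} (m : M) {y : E}
    (hy : y ∈ (extChartAt I m).target)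
    (hf : MDifferentiableAt I 𝓘(ℝ, ℝ) f ((extChartAt I m).symm y)) (v : E) :
    dFun I f ((extChartAt I m).symm y) (chartField I m v y) = fderiv ℝ (coordFun I f m) y v := by
  rw [chartField_eq]
  have h := mfderiv_comp y hf (mdifferentiableAt_chart_symm I m hy)
  have h2 : mfderiv 𝓘(ℝ, E) 𝓘(ℝ, ℝ) (f ∘ (extChartAt I m).symm) y
    = fderiv ℝ (coordFun I f m) y := by rw [mfderiv_eq_fderiv]; rfl
  rw [← h2, h]
  rfl

theorem target_mem_nhds [I.Boundaryless] (m : M) {y : E} (hy : y ∈ (extChartAt I m).target) :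
    (extChartAt I m).target ∈ nhds y :=
  (isOpen_extChartAt_target m).mem_nhds hy

theorem contMDiffAt_chart_symm [I.Boundaryless] [IsManifold I ∞ M] (m : M) {y : E}
    (hy : y ∈ (extChartAt I m).target) :
    ContMDiffAt 𝓘(ℝ, E) I ∞ (extChartAt I m).symm y :=
  (contMDiffOn_extChartAt_symm m).contMDiffAt (target_mem_nhds I m hy)

theorem contDiffAt_coordFun [I.Boundaryless] [IsManifold I ∞ M] {f : M → ℝ} (m : M) {y : E}
    (hy : y ∈ (extChartAt I m).target)
    (hf : ContMDiffAt I 𝓘(ℝ, ℝ) ∞ f ((extChartAt I m).symm y)) :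
    ContDiffAt ℝ ∞ (coordFun I f m) y :=
  (hf.comp y (contMDiffAt_chart_symm I m hy)).contDiffAt

theorem dFun_apply_eq [I.Boundaryless] [IsManifold I 1 M] {f : M → ℝ} (m : M)
    (hf : MDifferentiableAt I 𝓘(ℝ, ℝ) f m) (X : E) :
    dFun I f m X = fderiv ℝ (coordFun I f m) (extChartAt I m m) X := by
  refine (eval_chartField_self I m (fun p => dFun I f p) X).symm.trans ?_
  refine dFun_chartField I m (mem_extChartAt_target m) ?_ X
  rwa [extChartAt_to_inv]

/-- The components of a `1`-form in the chart at `m` are differentiable at `m`. -/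
def FormDifferentiableAt (α : ∀ m : M, TangentSpace I m →L[ℝ] ℝ) (m : M) : Prop :=
  ∀ v : E, DifferentiableAt ℝ (coordForm I α m v) (extChartAt I m m)

theorem coordForm_dFun_eventuallyEq [I.Boundaryless] [IsManifold I ∞ M] {f : M → ℝ}
    (hf : ContMDiff I 𝓘(ℝ, ℝ) ∞ f) (m : M) (v : E) :
    coordForm I (dFun I f) m v =ᶠ[nhds (extChartAt I m m)]
      fun y => fderiv ℝ (coordFun I f m) y v := by
  filter_upwards [target_mem_nhds I m (mem_extChartAt_target m)] with y hy
  have : IsManifold I 1 M := .of_le (n := ∞) (by simp)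
  exact dFun_chartField I m hy ((hf _).mdifferentiableAt (by simp)) v

theorem formDifferentiableAt_dFun [I.Boundaryless] [IsManifold I ∞ M] {f : M → ℝ}
    (hf : ContMDiff I 𝓘(ℝ, ℝ) ∞ f) (m : M) : FormDifferentiableAt I (dFun I f) m := by
  intro v
  refine DifferentiableAt.congr_of_eventuallyEq ?_ (coordForm_dFun_eventuallyEq I hf m v)
  have h := contDiffAt_coordFun I m (mem_extChartAt_target m) (hf ((extChartAt I m).symm _))
  exact ((h.fderiv_right (m := 1) (by norm_cast)).differentiableAt (by simp)).clm_apply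
    (differentiableAt_const v)

theorem dOne_dFun [I.Boundaryless] [IsManifold I ∞ M] {f : M → ℝ}
    (hf : ContMDiff I 𝓘(ℝ, ℝ) ∞ f) (m : M) :
    ∀ X Y : TangentSpace I m, dOne I (dFun I f) m X Y = 0 := by
  intro (X : E) (Y : E)
  have : IsManifold I 1 M := .of_le (n := ∞) (by simp)
  rw [dOne_eq, (coordForm_dFun_eventuallyEq I hf m Y).fderiv_eq,
    (coordForm_dFun_eventuallyEq I hf m X).fderiv_eq]
  have h := contDiffAt_coordFun I m (mem_extChartAt_target m) (hf ((extChartAt I m).symm _))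
  have hd := (h.fderiv_right (m := 1) (by norm_cast)).differentiableAt (by simp)
  have hs := h.isSymmSndFDerivAt (by simp; norm_cast)
  rw [fderiv_clm_apply hd (differentiableAt_const _), fderiv_clm_apply hd (differentiableAt_const _)]
  simpa [sub_eq_zero] using hs.eq X Y

theorem coordForm_self [IsManifold I 1 M] (α : ∀ m : M, TangentSpace I m →L[ℝ] ℝ) (m : M)
    (v : E) : coordForm I α m v (extChartAt I m m) = α m v :=
  eval_chartField_self I m (fun p => α p) v

variable {I} in
theorem FormDifferentiableAt.add {α β : ∀ m : M, TangentSpace I m →L[ℝ] ℝ} {m : M}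
    (hα : FormDifferentiableAt I α m) (hβ : FormDifferentiableAt I β m) :
    FormDifferentiableAt I (fun p => α p + β p) m :=
  fun v => (hα v).add (hβ v)

theorem dOne_add [I.Boundaryless] [IsManifold I 1 M] {α β : ∀ m : M, TangentSpace I m →L[ℝ] ℝ}
    {m : M} (hα : FormDifferentiableAt I α m) (hβ : FormDifferentiableAt I β m) :
    ∀ X Y : TangentSpace I m,
      dOne I (fun p => α p + β p) m X Y = dOne I α m X Y + dOne I β m X Y := by
  intro (X : E) (Y : E)
  have h : ∀ v, coordForm I (fun p => α p + β p) m v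
    = coordForm I α m v + coordForm I β m v := fun v => rfl
  rw [dOne_eq, dOne_eq, dOne_eq, h, h, fderiv_add (hα _) (hβ _), fderiv_add (hα _) (hβ _)]
  simp only [add_apply]
  ring

theorem differentiableAt_coordFun [I.Boundaryless] [IsManifold I ∞ M] {f : M → ℝ}
    (hf : ContMDiff I 𝓘(ℝ, ℝ) ∞ f) (m : M) :
    DifferentiableAt ℝ (coordFun I f m) (extChartAt I m m) :=
  (contDiffAt_coordFun I m (mem_extChartAt_target m)
    (hf ((extChartAt I m).symm _))).differentiableAt (by simp)

variable {I} in
theorem FormDifferentiableAt.smul [I.Boundaryless] [IsManifold I ∞ M] {f : M → ℝ}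
    (hf : ContMDiff I 𝓘(ℝ, ℝ) ∞ f)
    {α : ∀ m : M, TangentSpace I m →L[ℝ] ℝ} {m : M}
    (hα : FormDifferentiableAt I α m) :
    FormDifferentiableAt I (fun p => f p • α p) m :=
  fun v => (differentiableAt_coordFun I hf m).mul (hα v)

theorem dOne_smul [I.Boundaryless] [IsManifold I ∞ M] {f : M → ℝ}
    (hf : ContMDiff I 𝓘(ℝ, ℝ) ∞ f)
    {α : ∀ m : M, TangentSpace I m →L[ℝ] ℝ}
    {m : M} (hα : FormDifferentiableAt I α m) :
    ∀ X Y : TangentSpace I m,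
      dOne I (fun p => f p • α p) m X Y
        = f m * dOne I α m X Y + wedge I (dFun I f) α m X Y := by
  intro (X : E) (Y : E)
  have : IsManifold I 1 M := .of_le (n := ∞) (by simp)
  have h : ∀ v, coordForm I (fun p => f p • α p) m v
    = coordFun I f m * coordForm I α m v := fun v => rfl
  have hf' := differentiableAt_coordFun I hf m
  have h0 : coordFun I f m (extChartAt I m m) = f m := by
    unfold coordFun; rw [extChartAt_to_inv]
  have h1 : ∀ Z : E, dFun I f m Z = fderiv ℝ (coordFun I f m) (extChartAt I m m) Z :=
    fun Z => dFun_apply_eq I m ((hf m).mdifferentiableAt (by simp)) Z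
  have h2 := coordForm_self I α m
  rw [dOne_eq, dOne_eq, h, h, fderiv_mul hf' (hα _), fderiv_mul hf' (hα _), h0, h2, h2]
  unfold wedge
  rw [h1, h1]
  simp only [add_apply, smul_apply, smul_eq_mul]
  ring

/-- A vector field read in the preferred chart at `m`. -/
def coordField (V : ∀ p : M, TangentSpace I p) (m : M) (y : E) : E :=
  mfderiv I 𝓘(ℝ, E) (extChartAt I m) ((extChartAt I m).symm y) (V ((extChartAt I m).symm y))

/-- An endomorphism of the tangent bundle read in the preferred chart at `m`. -/
def coordEndo (J : ∀ p : M, TangentSpace I p →L[ℝ] TangentSpace I p) (m : M) (y : E) : E →L[ℝ] E :=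
  (mfderiv I 𝓘(ℝ, E) (extChartAt I m) ((extChartAt I m).symm y)).comp
    ((J ((extChartAt I m).symm y)).comp
      (mfderivWithin 𝓘(ℝ, E) I (extChartAt I m).symm (Set.range I) y))

/-- A bilinear form on the tangent bundle read in the preferred chart at `m`. -/
def coordBilin (g : ∀ p : M, TangentSpace I p →L[ℝ] TangentSpace I p →L[ℝ] ℝ) (m : M) (y : E) :
    E →L[ℝ] E →L[ℝ] ℝ :=
  (ContinuousLinearMap.precomp ℝ
    (mfderivWithin 𝓘(ℝ, E) I (extChartAt I m).symm (Set.range I) y)).comp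
  ((g ((extChartAt I m).symm y)).comp
    (mfderivWithin 𝓘(ℝ, E) I (extChartAt I m).symm (Set.range I) y))

theorem coordBilin_apply (g : ∀ p : M, TangentSpace I p →L[ℝ] TangentSpace I p →L[ℝ] ℝ) (m : M)
    (y v w : E) : coordBilin I g m y v w
      = g ((extChartAt I m).symm y) (chartField I m v y) (chartField I m w y) := rfl

theorem chartField_coordField [IsManifold I 1 M] (V : ∀ p : M, TangentSpace I p) (m : M) {y : E}
    (hy : y ∈ (extChartAt I m).target) :
    chartField I m (coordField I V m y) y = V ((extChartAt I m).symm y) :=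
  congrArg (fun L : TangentSpace I ((extChartAt I m).symm y) →L[ℝ]
    TangentSpace I ((extChartAt I m).symm y) => L (V ((extChartAt I m).symm y)))
    (mfderivWithin_extChartAt_symm_comp_mfderiv_extChartAt (I := I) hy)

theorem mfderiv_chart_chartField [IsManifold I 1 M] (m : M) {y : E}
    (hy : y ∈ (extChartAt I m).target) (v : E) :
    mfderiv I 𝓘(ℝ, E) (extChartAt I m) ((extChartAt I m).symm y) (chartField I m v y) = v :=
  congrArg (fun L : E →L[ℝ] E => L v)
    (mfderiv_extChartAt_comp_mfderivWithin_extChartAt_symm (I := I) hy)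

theorem chartField_coordEndo [IsManifold I 1 M]
    (J : ∀ p : M, TangentSpace I p →L[ℝ] TangentSpace I p) (m : M) {y : E}
    (hy : y ∈ (extChartAt I m).target) (v : E) :
    chartField I m (coordEndo I J m y v) y
      = J ((extChartAt I m).symm y) (chartField I m v y) :=
  congrArg (fun L : TangentSpace I ((extChartAt I m).symm y) →L[ℝ]
    TangentSpace I ((extChartAt I m).symm y) =>
      L (J ((extChartAt I m).symm y) (chartField I m v y)))
    (mfderivWithin_extChartAt_symm_comp_mfderiv_extChartAt (I := I) hy)

/-- The vector field near `m` which is `W` in the preferred chart at `m`. -/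
def fieldOfCoord (m : M) (W : E → E) (p : M) : TangentSpace I p :=
  (mfderiv I 𝓘(ℝ, E) (extChartAt I m) p).inverse (W (extChartAt I m p))

theorem fieldOfCoord_symm [IsManifold I 1 M] (m : M) (W : E → E) {y : E}
    (hy : y ∈ (extChartAt I m).target) :
    fieldOfCoord I m W ((extChartAt I m).symm y) = chartField I m (W y) y := by
  unfold fieldOfCoord chartField
  rw [(extChartAt I m).right_inv hy,
    ContinuousLinearMap.inverse_eq
      (mfderiv_extChartAt_comp_mfderivWithin_extChartAt_symm (I := I) hy)
      (mfderivWithin_extChartAt_symm_comp_mfderiv_extChartAt (I := I) hy)]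

theorem contMDiffAt_section_iff [I.Boundaryless] [IsManifold I ∞ M]
    (V : ∀ p : M, TangentSpace I p) (m : M) :
    ContMDiffAt I I.tangent ∞ (fun p => (⟨p, V p⟩ : TangentBundle I M)) m ↔
      ContDiffAt ℝ ∞ (coordField I V m) (extChartAt I m m) := by
  have : IsManifold I 1 M := .of_le (n := ∞) (by simp)
  have key : ∀ p ∈ (chartAt H m).source,
      (trivializationAt E (TangentSpace I) m ⟨p, V p⟩).2
        = mfderiv I 𝓘(ℝ, E) (extChartAt I m) p (V p) := by
    intro p hp
    have h1 := congrArg (fun L : TangentSpace I p →L[ℝ] E => L (V p))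
      (TangentBundle.continuousLinearMapAt_trivializationAt (I := I) (x₀ := m) hp)
    refine Eq.trans ?_ h1
    rw [Bundle.Trivialization.continuousLinearMapAt_apply,
      Bundle.Trivialization.linearMapAt_apply, if_pos (by simpa using hp)]
  have hs : (chartAt H m).source ∈ nhds m := chart_source_mem_nhds H m
  rw [Bundle.contMDiffAt_totalSpace]
  constructor
  · rintro ⟨-, h⟩
    have hc : ContMDiffAt 𝓘(ℝ, E) 𝓘(ℝ, E) ∞
        ((fun p => (trivializationAt E (TangentSpace I) m ⟨p, V p⟩).2) ∘ (extChartAt I m).symm)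
        (extChartAt I m m) := by
      refine ContMDiffAt.comp _ ?_ (contMDiffAt_chart_symm I m (mem_extChartAt_target m))
      rw [extChartAt_to_inv]
      exact h
    refine hc.contDiffAt.congr_of_eventuallyEq ?_
    filter_upwards [target_mem_nhds I m (mem_extChartAt_target m)] with y hy
    have hy' := (extChartAt I m).map_target hy
    rw [extChartAt_source] at hy'
    exact (key _ hy').symm
  · intro h
    refine ⟨contMDiffAt_id, ?_⟩
    have hc : ContMDiffAt I 𝓘(ℝ, E) ∞ (coordField I V m ∘ extChartAt I m) m :=
      h.contMDiffAt.comp m contMDiffAt_extChartAt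
    refine hc.congr_of_eventuallyEq ?_
    filter_upwards [hs] with p hp
    rw [key p hp]
    unfold coordField
    simp only [Function.comp]
    rw [(extChartAt I m).left_inv (by rwa [extChartAt_source])]

theorem contMDiffAt_fieldOfCoord [I.Boundaryless] [IsManifold I ∞ M] (m : M) {W : E → E}
    (hW : ContDiffAt ℝ ∞ W (extChartAt I m m)) :
    ContMDiffAt I I.tangent ∞ (fun p => (⟨p, fieldOfCoord I m W p⟩ : TangentBundle I M)) m := by
  have : IsManifold I 1 M := .of_le (n := ∞) (by simp)
  rw [contMDiffAt_section_iff]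
  refine hW.congr_of_eventuallyEq ?_
  filter_upwards [target_mem_nhds I m (mem_extChartAt_target m)] with y hy
  unfold coordField
  rw [fieldOfCoord_symm I m W hy]
  exact mfderiv_chart_chartField I m hy (W y)

theorem contDiffAt_clm_apply_iff {D E F : Type*} [NormedAddCommGroup D] [NormedSpace ℝ D]
    [NormedAddCommGroup E] [NormedSpace ℝ E] [NormedAddCommGroup F] [NormedSpace ℝ F]
    [FiniteDimensional ℝ E] {n : WithTop ℕ∞} {f : D → E →L[ℝ] F} {x : D} :
    ContDiffAt ℝ n f x ↔ ∀ v, ContDiffAt ℝ n (fun y => f y v) x := by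
  refine ⟨fun h y => h.clm_apply contDiffAt_const, fun h => ?_⟩
  have hd : Module.finrank ℝ E = Module.finrank ℝ (Fin (Module.finrank ℝ E) → ℝ) :=
    (Module.finrank_fin_fun ℝ).symm
  let e₁ := ContinuousLinearEquiv.ofFinrankEq hd
  let e₂ := (e₁.arrowCongr (1 : F ≃L[ℝ] F)).trans
    (ContinuousLinearEquiv.piRing (Fin (Module.finrank ℝ E)))
  rw [← Function.id_comp f, ← e₂.symm_comp_self]
  exact e₂.symm.contDiff.contDiffAt.comp x (contDiffAt_pi.mpr fun i => h _)

variable [FiniteDimensional ℝ E]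

theorem contDiffAt_coordEndo [I.Boundaryless] [IsManifold I ∞ M]
    {J : ∀ p : M, TangentSpace I p →L[ℝ] TangentSpace I p}
    (hJ : ContMDiff I (I.prod 𝓘(ℝ, E →L[ℝ] E)) ∞
      (fun m => Bundle.TotalSpace.mk' (E →L[ℝ] E)
        (E := fun m : M => TangentSpace I m →L[ℝ] TangentSpace I m) m (J m))) (m : M) :
    ContDiffAt ℝ ∞ (coordEndo I J m) (extChartAt I m m) := by
  have : IsManifold I 1 M := .of_le (n := ∞) (by simp)
  rw [contDiffAt_clm_apply_iff]
  intro v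
  have h := (hJ m).clm_bundle_apply (contMDiffAt_fieldOfCoord I m (contDiffAt_const (c := v)))
  refine ((contMDiffAt_section_iff I _ m).1 h).congr_of_eventuallyEq ?_
  filter_upwards [target_mem_nhds I m (mem_extChartAt_target m)] with y hy
  exact congrArg (fun w => mfderiv I 𝓘(ℝ, E) (extChartAt I m) ((extChartAt I m).symm y)
    (J ((extChartAt I m).symm y) w)) (fieldOfCoord_symm I m (fun _ => v) hy).symm

theorem contDiffAt_coordBilin [I.Boundaryless] [IsManifold I ∞ M] (g : SmoothMetric I M) (m : M) :
    ContDiffAt ℝ ∞ (coordBilin I g.inner m) (extChartAt I m m) := by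
  have : IsManifold I 1 M := .of_le (n := ∞) (by simp)
  rw [contDiffAt_clm_apply_iff]
  intro v
  rw [contDiffAt_clm_apply_iff]
  intro w
  have h : ContMDiffAt I (I.prod 𝓘(ℝ)) ∞
      (fun p ↦ Bundle.TotalSpace.mk' ℝ (E := Bundle.Trivial M ℝ) p
        (g.inner p (fieldOfCoord I m (fun _ => v) p) (fieldOfCoord I m (fun _ => w) p))) m :=
    ContMDiffAt.clm_bundle_apply₂ (F₁ := E) (F₂ := E) (g.contMDiff m)
      (contMDiffAt_fieldOfCoord I m (contDiffAt_const (c := v)))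
      (contMDiffAt_fieldOfCoord I m (contDiffAt_const (c := w)))
  simp only [Bundle.contMDiffAt_totalSpace] at h
  have h2 := h.2
  have hc : ContMDiffAt 𝓘(ℝ, E) 𝓘(ℝ, ℝ) ∞
      ((fun p => g.inner p (fieldOfCoord I m (fun _ => v) p) (fieldOfCoord I m (fun _ => w) p))
        ∘ (extChartAt I m).symm) (extChartAt I m m) := by
    refine ContMDiffAt.comp _ ?_ (contMDiffAt_chart_symm I m (mem_extChartAt_target m))
    rw [extChartAt_to_inv]
    exact h2
  refine hc.contDiffAt.congr_of_eventuallyEq ?_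
  filter_upwards [target_mem_nhds I m (mem_extChartAt_target m)] with y hy
  simp only [Function.comp]
  rw [fieldOfCoord_symm I m _ hy, fieldOfCoord_symm I m _ hy]
  rfl

end Charts

section PotentialForms

variable {E : Type*} [NormedAddCommGroup E] [NormedSpace ℝ E]
  {H : Type*} [TopologicalSpace H] {I : ModelWithCorners ℝ E H} [I.Boundaryless]
  {M : Type*} [TopologicalSpace M] [ChartedSpace H M] [IsManifold I ∞ M]

theorem coordForm_dc {f : M → ℝ} (hf : ContMDiff I 𝓘(ℝ, ℝ) ∞ f)
    (J : ∀ m : M, TangentSpace I m →L[ℝ] TangentSpace I m) (m : M) (v : E) {y : E}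
    (hy : y ∈ (extChartAt I m).target) :
    coordForm I (dc I J f) m v y = -fderiv ℝ (coordFun I f m) y (coordEndo I J m y v) := by
  have : IsManifold I 1 M := .of_le (n := ∞) (by simp)
  rw [← dFun_chartField I m hy ((hf _).mdifferentiableAt (by simp)) (coordEndo I J m y v),
    chartField_coordEndo I J m hy]
  rfl

theorem coordForm_dc_eventuallyEq {f : M → ℝ} (hf : ContMDiff I 𝓘(ℝ, ℝ) ∞ f)
    (J : ∀ m : M, TangentSpace I m →L[ℝ] TangentSpace I m) (m : M) (v : E) :
    coordForm I (dc I J f) m v =ᶠ[nhds (extChartAt I m m)]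
      fun y => -fderiv ℝ (coordFun I f m) y (coordEndo I J m y v) := by
  filter_upwards [target_mem_nhds I m (mem_extChartAt_target m)] with y hy
  exact coordForm_dc hf J m v hy

theorem formDifferentiableAt_dc [FiniteDimensional ℝ E] {f : M → ℝ} (hf : ContMDiff I 𝓘(ℝ, ℝ) ∞ f)
    {J : ∀ m : M, TangentSpace I m →L[ℝ] TangentSpace I m}
    (hJ : ContMDiff I (I.prod 𝓘(ℝ, E →L[ℝ] E)) ∞
      (fun m => Bundle.TotalSpace.mk' (E →L[ℝ] E)
        (E := fun m : M => TangentSpace I m →L[ℝ] TangentSpace I m) m (J m))) (m : M) :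
    FormDifferentiableAt I (dc I J f) m := by
  intro v
  refine DifferentiableAt.congr_of_eventuallyEq ?_ (coordForm_dc_eventuallyEq hf J m v)
  have h := contDiffAt_coordFun I m (mem_extChartAt_target m) (hf ((extChartAt I m).symm _))
  have hd := (h.fderiv_right (m := 1) (by norm_cast)).differentiableAt (by simp)
  have hJ' := (contDiffAt_coordEndo I hJ m).differentiableAt (by simp)
  exact (hd.clm_apply (hJ'.clm_apply (differentiableAt_const v))).neg

/-- The exterior derivative of `f dh - h df` is `2 df ∧ dh`. -/
theorem dOne_smul_dFun_sub {f h : M → ℝ} (hf : ContMDiff I 𝓘(ℝ, ℝ) ∞ f)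
    (hh : ContMDiff I 𝓘(ℝ, ℝ) ∞ h) (m : M) :
    FormDifferentiableAt I (fun p => f p • dFun I h p + (-h p) • dFun I f p) m ∧
    ∀ X Y : TangentSpace I m, dOne I (fun p => f p • dFun I h p + (-h p) • dFun I f p) m X Y
      = 2 * wedge I (dFun I f) (dFun I h) m X Y := by
  have : IsManifold I 1 M := .of_le (n := ∞) (by simp)
  have d1 := formDifferentiableAt_dFun I hf m
  have d2 := formDifferentiableAt_dFun I hh m
  have hn : ContMDiff I 𝓘(ℝ, ℝ) ∞ (fun p => -h p) := hh.neg
  refine ⟨(d2.smul hf).add (d1.smul hn), fun X Y => ?_⟩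
  rw [dOne_add I (d2.smul hf) (d1.smul hn), dOne_smul I hf d2, dOne_smul I hn d1,
    dOne_dFun I hf, dOne_dFun I hh]
  have e : ∀ Z, dFun I (fun p => -h p) m Z = -dFun I h m Z := by
    intro Z
    have h1 : mfderiv I 𝓘(ℝ, ℝ) (fun p => -h p) m = -mfderiv I 𝓘(ℝ, ℝ) h m :=
      mfderiv_neg
    unfold dFun
    rw [h1]
    rfl
  unfold wedge
  rw [e, e]
  ring

end PotentialForms

/-! ### Pointwise algebra of the deformation -/

theorem sum_fin_three_cyclic (i : Fin 3) (f : Fin 3 → ℝ) :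
    ∑ l, f l = f i + f (i + 1) + f (i + 2) := by
  rw [Fin.sum_univ_three]
  match i with
  | 0 => rfl
  | 1 => change _ = f 1 + f 2 + f 0; ring
  | 2 => change _ = f 2 + f 0 + f 1; ring

section Pointwise

variable {E : Type*} [NormedAddCommGroup E] [NormedSpace ℝ E]
  {H : Type*} [TopologicalSpace H] {I : ModelWithCorners ℝ E H}
  {M : Type*} [TopologicalSpace M] [ChartedSpace H M] [IsManifold I ∞ M]

namespace Hyperkahler

variable (hk : Hyperkahler I M) (m : M)

theorem J_mul_succ (i : Fin 3) (X : TangentSpace I m) :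
    hk.J i m (hk.J (i + 1) m X) = hk.J (i + 2) m X := by
  have h01 : ∀ X, hk.J 0 m (hk.J 1 m X) = hk.J 2 m X := fun X => by
    have h := hk.J_mul m (hk.J 2 m X)
    rw [hk.J_sq, map_neg, map_neg, neg_inj] at h
    exact h
  have h12 : ∀ X, hk.J 1 m (hk.J 2 m X) = hk.J 0 m X := fun X => by
    have h := congrArg (hk.J 0 m) (hk.J_mul m X)
    rw [hk.J_sq, map_neg, neg_inj] at h
    exact h
  fin_cases i
  · exact h01 X
  · exact h12 X
  · have h := h12 (hk.J 0 m X)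
    rw [hk.J_sq] at h
    have h2 := congrArg (hk.J 1 m) h
    rw [hk.J_sq, map_neg, neg_inj] at h2
    exact h2

theorem J_mul_succ_succ (i : Fin 3) (X : TangentSpace I m) :
    hk.J i m (hk.J (i + 2) m X) = -hk.J (i + 1) m X := by
  rw [← hk.J_mul_succ m i, hk.J_sq]

theorem inner_J_left (i : Fin 3) (X Y : TangentSpace I m) :
    hk.g.inner m (hk.J i m X) Y = -hk.g.inner m X (hk.J i m Y) := by
  rw [← hk.J_isometry i m X (hk.J i m Y), hk.J_sq, map_neg, neg_neg]

theorem inner_J_self (i : Fin 3) (X : TangentSpace I m) :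
    hk.g.inner m (hk.J i m X) X = 0 := by
  have h := hk.inner_J_left m i X X
  rw [hk.g.symm m X] at h
  linarith

theorem inner_self_nonneg (X : TangentSpace I m) : 0 ≤ hk.g.inner m X X := by
  by_cases h : X = 0
  · simp [h]
  · exact (hk.g.pos m X h).le

end Hyperkahler

theorem metric_cauchySchwarz (g : SmoothMetric I M) (m : M) (X Y : TangentSpace I m) :
    g.inner m X Y ^ 2 ≤ g.inner m X X * g.inner m Y Y := by
  by_cases h : Y = 0
  · simp [h]
  · have hp := g.pos m Y h
    have h0 : 0 ≤ g.inner m (g.inner m Y Y • X - g.inner m X Y • Y)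
        (g.inner m Y Y • X - g.inner m X Y • Y) := by
      by_cases h : g.inner m Y Y • X - g.inner m X Y • Y = 0
      · simp [h]
      · exact (g.pos m _ h).le
    simp only [map_sub, map_smul, sub_apply, smul_apply, smul_eq_mul, g.symm m Y X] at h0
    nlinarith

variable (hk : Hyperkahler I M) (A : RAction I M) (x : Fin 3 → M → ℝ) (a : ℝ) (m : M)

/-- The quaternion `s + c₁ i + c₂ j + c₃ k`. -/
def quat (s : ℝ) (c : Fin 3 → ℝ) : ℍ[ℝ] := ⟨s, c 0, c 1, c 2⟩

@[simp] theorem quat_re (s : ℝ) (c : Fin 3 → ℝ) : (quat s c).re = s := rfl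
@[simp] theorem quat_imI (s : ℝ) (c : Fin 3 → ℝ) : (quat s c).imI = c 0 := rfl
@[simp] theorem quat_imJ (s : ℝ) (c : Fin 3 → ℝ) : (quat s c).imJ = c 1 := rfl
@[simp] theorem quat_imK (s : ℝ) (c : Fin 3 → ℝ) : (quat s c).imK = c 2 := rfl

theorem imUnit_zero : imUnit 0 = quat 0 ![1, 0, 0] := rfl
theorem imUnit_one : imUnit 1 = quat 0 ![0, 1, 0] := rfl
theorem imUnit_two : imUnit 2 = quat 0 ![0, 0, 1] := rfl

theorem sum_imUnit (c : Fin 3 → ℝ) : ∑ i, c i • imUnit i = quat 0 c := by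
  rw [Fin.sum_univ_three, imUnit_zero, imUnit_one, imUnit_two]
  ext <;> simp

theorem inner_quat (s t : ℝ) (c d : Fin 3 → ℝ) :
    inner ℝ (quat s c) (quat t d) = s * t + ∑ i, c i * d i := by
  rw [Quaternion.inner_def, Fin.sum_univ_three]
  simp
  ring

theorem inner_one_quaternion (q : ℍ[ℝ]) : inner ℝ 1 q = q.re := by
  rw [Quaternion.inner_def]
  simp

theorem re_imUnit_mul_quat (i : Fin 3) (s : ℝ) (c : Fin 3 → ℝ) :
    (imUnit i * quat s c).re = -c i := by
  match i with
  | 0 => rw [imUnit_zero]; simp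
  | 1 => rw [imUnit_one]; simp
  | 2 => rw [imUnit_two]; simp

theorem prodMetric_apply (v w : TangentSpace I m × ℍ[ℝ]) :
    prodMetric hk m v w = hk.g.inner m v.1 w.1 + inner ℝ v.2 w.2 := rfl

omit [IsManifold I ∞ M] in
theorem dSlice_apply (X : TangentSpace I m) :
    dSlice x a m X = (X, quat 0 fun i => a * dFun I (x i) m X) := by
  rw [← sum_imUnit]
  refine Prod.ext rfl ?_
  change (∑ i, (a • dFun I (x i) m).smulRight (imUnit i)) X = _
  rw [sum_apply]
  rfl

/-- The squared length `1 + a² |T|²` of the generator of the action on `M × ℍ`. -/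
def genNorm : ℝ := 1 + a ^ 2 * hk.g.inner m (A.gen m) (A.gen m)

theorem genNorm_pos : 0 < genNorm hk A a m := by
  have := hk.inner_self_nonneg m (A.gen m)
  unfold genNorm
  positivity

theorem horLift_apply (X : TangentSpace I m) :
    horLift hk A x a m X = (X - (a ^ 2 / genNorm hk A a m * hk.g.inner m (A.gen m) X) • A.gen m,
      quat (-(a / genNorm hk A a m * hk.g.inner m (A.gen m) X)) fun i => a * dFun I (x i) m X) := by
  have hZ : prodMetric hk m (prodGen A a m) (prodGen A a m) = genNorm hk A a m := by
    rw [prodMetric_apply, prodGen, inner_one_quaternion, map_smul, map_smul]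
    simp only [smul_apply, smul_eq_mul, Quaternion.re_one, genNorm]
    ring
  have h2 : prodMetric hk m (prodGen A a m) (dSlice x a m X)
      = a * hk.g.inner m (A.gen m) X := by
    rw [dSlice_apply, prodMetric_apply, prodGen, inner_one_quaternion, map_smul, quat_re, add_zero]
    rfl
  have h3 : horLift hk A x a m X = dSlice x a m X
      - ((prodMetric hk m (prodGen A a m) (prodGen A a m))⁻¹
        * prodMetric hk m (prodGen A a m) (dSlice x a m X)) • prodGen A a m := rfl
  rw [h3, hZ, h2, dSlice_apply]
  refine Prod.ext ?_ ?_
  · change X - ((genNorm hk A a m)⁻¹ * (a * hk.g.inner m (A.gen m) X)) • (a • A.gen m) = _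
    rw [smul_smul]
    congr 2
    ring
  · change quat 0 (fun i => a * dFun I (x i) m X)
      - ((genNorm hk A a m)⁻¹ * (a * hk.g.inner m (A.gen m) X)) • (1 : ℍ[ℝ]) = _
    ext <;> simp
    ring

theorem deformedMetric_apply (X Y : TangentSpace I m) :
    deformedMetric hk A x a m X Y = hk.g.inner m X Y
      + a ^ 2 * ∑ i, dFun I (x i) m X * dFun I (x i) m Y
      - a ^ 2 / genNorm hk A a m * hk.g.inner m (A.gen m) X * hk.g.inner m (A.gen m) Y := by
  have hN := (genNorm_pos hk A a m).ne'
  have hN' : hk.g.inner m (A.gen m) (A.gen m) * a ^ 2 = genNorm hk A a m - 1 := by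
    unfold genNorm; ring
  unfold deformedMetric
  rw [horLift_apply, horLift_apply, prodMetric_apply, inner_quat]
  simp only [map_sub, map_smul, sub_apply, smul_apply, smul_eq_mul, hk.g.symm m X (A.gen m),
    Fin.sum_univ_three]
  field_simp
  linear_combination (a ^ 2 * hk.g.inner m (A.gen m) X * hk.g.inner m (A.gen m) Y) * hN'

theorem deformedJ_apply (i : Fin 3) (X : TangentSpace I m) :
    deformedJ hk A x a i m X = hk.J i m X
      - (a ^ 2 / genNorm hk A a m * hk.g.inner m (A.gen m) X) • hk.J i m (A.gen m)
      + (a ^ 2 * dFun I (x i) m X) • A.gen m := by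
  have h : deformedJ hk A x a i m X = hk.J i m (horLift hk A x a m X).1
    - (inner ℝ (1 : ℍ[ℝ]) (imUnit i * (horLift hk A x a m X).2)) • (a • A.gen m) := rfl
  rw [h, horLift_apply, inner_one_quaternion, re_imUnit_mul_quat, map_sub, map_smul, smul_smul]
  rw [show -(a * dFun I (x i) m X) * a = -(a ^ 2 * dFun I (x i) m X) by ring, neg_smul,
    sub_neg_eq_add]

theorem deformedMetric_symm (X Y : TangentSpace I m) :
    deformedMetric hk A x a m X Y = deformedMetric hk A x a m Y X := by
  rw [deformedMetric_apply, deformedMetric_apply, hk.g.symm m X Y]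
  simp only [Fin.sum_univ_three]
  ring

theorem deformedMetric_neg (X Y : TangentSpace I m) :
    deformedMetric hk A x a m (-X) Y = -deformedMetric hk A x a m X Y := by
  rw [deformedMetric_apply, deformedMetric_apply]
  simp only [Fin.sum_univ_three, map_neg, neg_apply]
  ring

theorem metric_sub_pos {X : TangentSpace I m} (hX : X ≠ 0) :
    0 < hk.g.inner m X X - a ^ 2 / genNorm hk A a m * hk.g.inner m (A.gen m) X ^ 2 := by
  have hN := genNorm_pos hk A a m
  have hN' : hk.g.inner m (A.gen m) (A.gen m) * a ^ 2 = genNorm hk A a m - 1 := by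
    unfold genNorm; ring
  have hcs := metric_cauchySchwarz hk.g m (A.gen m) X
  have hp := hk.g.pos m X hX
  have : hk.g.inner m X X - a ^ 2 / genNorm hk A a m * hk.g.inner m (A.gen m) X ^ 2
      = (genNorm hk A a m * hk.g.inner m X X - a ^ 2 * hk.g.inner m (A.gen m) X ^ 2)
        / genNorm hk A a m := by field_simp
  rw [this]
  apply div_pos _ hN
  have := mul_le_mul_of_nonneg_left hcs (sq_nonneg a)
  nlinarith

theorem deformedMetric_pos {X : TangentSpace I m} (hX : X ≠ 0) :
    0 < deformedMetric hk A x a m X X := by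
  have h := metric_sub_pos hk A a m hX
  rw [deformedMetric_apply]
  have : 0 ≤ a ^ 2 * ∑ i, dFun I (x i) m X * dFun I (x i) m X :=
    mul_nonneg (sq_nonneg a) (Finset.sum_nonneg fun i _ => mul_self_nonneg _)
  linarith

section MomentMap

variable {hk A x} (hx : IsMomentMap hk A x)
include hx

theorem IsMomentMap.dFun_gen (i : Fin 3) : dFun I (x i) m (A.gen m) = 0 := by
  rw [(hx i).2, Hyperkahler.omega, hk.inner_J_self, neg_zero]

theorem IsMomentMap.dFun_J (i : Fin 3) (X : TangentSpace I m) :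
    dFun I (x i) m (hk.J i m X) = -hk.g.inner m (A.gen m) X := by
  rw [(hx i).2, Hyperkahler.omega, hk.J_isometry]

theorem IsMomentMap.dFun_succ_J (i : Fin 3) (X : TangentSpace I m) :
    dFun I (x (i + 1)) m (hk.J i m X) = -dFun I (x (i + 2)) m X := by
  have h := hk.inner_J_left m i (hk.J (i + 1) m (A.gen m)) X
  rw [hk.J_mul_succ] at h
  rw [(hx _).2, (hx _).2, Hyperkahler.omega, Hyperkahler.omega, h, neg_neg]

theorem IsMomentMap.dFun_succ_succ_J (i : Fin 3) (X : TangentSpace I m) :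
    dFun I (x (i + 2)) m (hk.J i m X) = dFun I (x (i + 1)) m X := by
  have h := hk.inner_J_left m i (hk.J (i + 2) m (A.gen m)) X
  rw [hk.J_mul_succ_succ] at h
  rw [(hx _).2, (hx _).2, Hyperkahler.omega, Hyperkahler.omega, ← h]
  simp

theorem IsMomentMap.inner_gen_J (i : Fin 3) (X : TangentSpace I m) :
    hk.g.inner m (A.gen m) (hk.J i m X) = dFun I (x i) m X := by
  rw [(hx i).2, Hyperkahler.omega, hk.inner_J_left, neg_neg]

/-- The deformed Kähler form is `ω_i + a² dx_j ∧ dx_k`. -/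
theorem IsMomentMap.deformedMetric_J (i : Fin 3) (X Y : TangentSpace I m) :
    deformedMetric hk A x a m (deformedJ hk A x a i m X) Y = hk.omega i m X Y
      + a ^ 2 * wedge I (dFun I (x (i + 1))) (dFun I (x (i + 2))) m X Y := by
  have hN := (genNorm_pos hk A a m).ne'
  have hN' : hk.g.inner m (A.gen m) (A.gen m) * a ^ 2 = genNorm hk A a m - 1 := by
    unfold genNorm; ring
  have h1 : hk.g.inner m (hk.J i m (A.gen m)) Y = -dFun I (x i) m Y := by
    rw [(hx i).2]; simp [Hyperkahler.omega]
  have h2 : hk.g.inner m (A.gen m) (hk.J i m (A.gen m)) = 0 := by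
    rw [hx.inner_gen_J, hx.dFun_gen]
  rw [deformedMetric_apply, deformedJ_apply, sum_fin_three_cyclic i]
  simp only [map_sub, map_add, map_smul, sub_apply, add_apply, smul_apply, smul_eq_mul,
    hx.dFun_gen, hx.dFun_J, hx.dFun_succ_J, hx.dFun_succ_succ_J, hx.inner_gen_J, h1, wedge,
    Hyperkahler.omega, mul_zero, add_zero, sub_zero, neg_zero]
  field_simp
  linear_combination (a ^ 2 * hk.g.inner m (A.gen m) X * dFun I (x i) m Y
    - a ^ 2 * dFun I (x i) m X * hk.g.inner m (A.gen m) Y) * hN'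

theorem IsMomentMap.deformedJ_sq (i : Fin 3) (X : TangentSpace I m) :
    deformedJ hk A x a i m (deformedJ hk A x a i m X) = -X := by
  have hN := (genNorm_pos hk A a m).ne'
  have hN' : hk.g.inner m (A.gen m) (A.gen m) * a ^ 2 = genNorm hk A a m - 1 := by
    unfold genNorm; ring
  have h2 : hk.g.inner m (A.gen m) (hk.J i m (A.gen m)) = 0 := by
    rw [hx.inner_gen_J, hx.dFun_gen]
  have hJ := deformedJ_apply hk A x a m i X
  have hθ : hk.g.inner m (A.gen m) (deformedJ hk A x a i m X)
      = genNorm hk A a m * dFun I (x i) m X := by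
    rw [hJ]
    simp only [map_sub, map_add, map_smul, smul_eq_mul, hx.inner_gen_J, hx.dFun_gen]
    linear_combination dFun I (x i) m X * hN'
  have hd : dFun I (x i) m (deformedJ hk A x a i m X)
      = -(hk.g.inner m (A.gen m) X / genNorm hk A a m) := by
    rw [hJ]
    simp only [map_sub, map_add, map_smul, smul_eq_mul, hx.dFun_J, hx.dFun_gen]
    field_simp
    linear_combination (hk.g.inner m (A.gen m) X) * hN'
  rw [deformedJ_apply hk A x a m i (deformedJ hk A x a i m X), hθ, hd, hJ]
  simp only [map_sub, map_add, map_smul, hk.J_sq]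
  rw [show a ^ 2 / genNorm hk A a m * (genNorm hk A a m * dFun I (x i) m X)
    = a ^ 2 * dFun I (x i) m X by field_simp]
  module

theorem IsMomentMap.deformedMetric_J_left (i : Fin 3) (X Y : TangentSpace I m) :
    deformedMetric hk A x a m (deformedJ hk A x a i m X) Y
      = -deformedMetric hk A x a m (deformedJ hk A x a i m Y) X := by
  rw [hx.deformedMetric_J, hx.deformedMetric_J, Hyperkahler.omega, Hyperkahler.omega,
    hk.inner_J_left, hk.g.symm m X]
  unfold wedge
  ring

theorem IsMomentMap.deformedMetric_J_J (i : Fin 3) (X Y : TangentSpace I m) :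
    deformedMetric hk A x a m (deformedJ hk A x a i m X) (deformedJ hk A x a i m Y)
      = deformedMetric hk A x a m X Y := by
  rw [hx.deformedMetric_J_left, hx.deformedJ_sq, deformedMetric_neg, neg_neg,
    deformedMetric_symm]

end MomentMap

end Pointwise

section DeformedPotential

variable {E : Type*} [NormedAddCommGroup E] [NormedSpace ℝ E] 
  {H : Type*} [TopologicalSpace H] {I : ModelWithCorners ℝ E H}
  {M : Type*} [TopologicalSpace M] [ChartedSpace H M] [IsManifold I ∞ M]
  {hk : Hyperkahler I M} {A : RAction I M} {x : Fin 3 → M → ℝ}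

omit [IsManifold I ∞ M] in
theorem RAction.contMDiff_orbit (A : RAction I M) (m : M) :
    ContMDiff 𝓘(ℝ, ℝ) I ∞ (fun s : ℝ => A.act s m) :=
  A.smooth.comp (contMDiff_id.prodMk contMDiff_const)

omit [IsManifold I ∞ M] in
theorem RAction.hasDerivAt_orbit_zero (A : RAction I M) {f : M → ℝ}
    (hf : MDifferentiable I 𝓘(ℝ, ℝ) f) (m : M) :
    HasDerivAt (fun s => f (A.act s m)) (dFun I f m (A.gen m)) 0 := by
  have h1 : MDifferentiableAt 𝓘(ℝ, ℝ) I (fun s : ℝ => A.act s m) 0 :=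
    (A.contMDiff_orbit m _).mdifferentiableAt (by simp)
  have hd : DifferentiableAt ℝ (fun s => f (A.act s m)) 0 :=
    ((hf _).comp 0 h1).differentiableAt
  have h2 := mfderiv_comp (0 : ℝ) (hf (A.act 0 m)) h1
  have key : ∀ (p : M) (_ : p = m) (w : TangentSpace I p), (w : E) = A.gen m →
      dFun I f p w = dFun I f m (A.gen m) := by
    rintro p rfl w h
    exact congrArg (dFun I f p) h
  have h3 : fderiv ℝ (fun s => f (A.act s m)) 0 (1 : ℝ) = dFun I f m (A.gen m) := by
    rw [← key _ (A.zero_act m) (mfderiv 𝓘(ℝ, ℝ) I (fun t : ℝ => A.act t m) 0 (1 : ℝ)) rfl,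
      ← mfderiv_eq_fderiv]
    exact congrArg (fun L : ℝ →L[ℝ] ℝ => L 1) h2
  rw [← h3]
  exact hd.hasDerivAt

omit [IsManifold I ∞ M] in
theorem RAction.hasDerivAt_orbit (A : RAction I M) {f : M → ℝ}
    (hf : MDifferentiable I 𝓘(ℝ, ℝ) f) (m : M) (t : ℝ) :
    HasDerivAt (fun s => f (A.act s m)) (dFun I f (A.act t m) (A.gen (A.act t m))) t := by
  have h := A.hasDerivAt_orbit_zero hf (A.act t m)
  have h2 : (fun s => f (A.act s m)) = fun s => (fun u => f (A.act u (A.act t m))) (s - t) := by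
    funext s
    simp only
    rw [← A.add_act, sub_add_cancel]
  rw [h2]
  rw [← sub_self t] at h
  exact h.comp_sub_const t t

omit [IsManifold I ∞ M] in
/-- A function whose differential vanishes on the generator is invariant. -/
theorem RAction.invariant_of_dFun_gen {f : M → ℝ} (hf : MDifferentiable I 𝓘(ℝ, ℝ) f)
    (h : ∀ m, dFun I f m (A.gen m) = 0) : A.Invariant f := by
  intro t m
  have hd : ∀ s : ℝ, HasDerivAt (fun s => f (A.act s m)) 0 s := by
    intro s
    have h1 := A.hasDerivAt_orbit hf m s
    rwa [h] at h1
  have hc := is_const_of_deriv_eq_zero (fun s => (hd s).differentiableAt) (fun s => (hd s).deriv)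
    t 0
  simpa [A.zero_act] using hc

omit [IsManifold I ∞ M] in
/-- The differential of an invariant function vanishes on the generator. -/
theorem RAction.Invariant.dFun_gen {f : M → ℝ} (hf : MDifferentiable I 𝓘(ℝ, ℝ) f)
    (h : A.Invariant f) (m : M) : dFun I f m (A.gen m) = 0 := by
  have h1 := A.hasDerivAt_orbit_zero hf m
  have h2 : (fun s => f (A.act s m)) = fun _ => f m := funext fun s => h s m
  rw [h2] at h1
  exact h1.unique (hasDerivAt_const _ _)

omit [IsManifold I ∞ M] in
theorem contMDiff_deformedPotential {K : M → ℝ} (hK : ContMDiff I 𝓘(ℝ, ℝ) ∞ K)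
    (hx : ∀ i, ContMDiff I 𝓘(ℝ, ℝ) ∞ (x i)) (a : ℝ) (i : Fin 3) :
    ContMDiff I 𝓘(ℝ, ℝ) ∞ (deformedPotential x a i K) := by
  have h : deformedPotential x a i K
      = fun m => K m + a ^ 2 / 2 * (x i m * x i m + ∑ j, x j m * x j m) := by
    funext m
    simp only [deformedPotential, sq]
  rw [h]
  exact hK.add (contMDiff_const.mul (((hx i).mul (hx i)).add
    (contMDiff_finsetSum fun j _ => (hx j).mul (hx j))))

omit [IsManifold I ∞ M] in
theorem dFun_deformedPotential {K : M → ℝ} (hK : ContMDiff I 𝓘(ℝ, ℝ) ∞ K)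
    (hx : ∀ i, ContMDiff I 𝓘(ℝ, ℝ) ∞ (x i)) (a : ℝ) (i : Fin 3) (m : M)
    (X : TangentSpace I m) :
    dFun I (deformedPotential x a i K) m X = dFun I K m X
      + a ^ 2 * (2 * x i m * dFun I (x i) m X + x (i + 1) m * dFun I (x (i + 1)) m X
        + x (i + 2) m * dFun I (x (i + 2)) m X) := by
  have hd : ∀ j, HasMFDerivAt I 𝓘(ℝ, ℝ) (x j) m (dFun I (x j) m) := fun j =>
    ((hx j m).mdifferentiableAt (by simp)).hasMFDerivAt
  have hK' : HasMFDerivAt I 𝓘(ℝ, ℝ) K m (dFun I K m) :=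
    ((hK m).mdifferentiableAt (by simp)).hasMFDerivAt
  have h : deformedPotential x a i K = K + ((a ^ 2) • (x i * x i)
      + (a ^ 2 / 2) • (x (i + 1) * x (i + 1) + x (i + 2) * x (i + 2))) := by
    funext m
    simp only [deformedPotential, sum_fin_three_cyclic i, Pi.add_apply, Pi.mul_apply,
      Pi.smul_apply, smul_eq_mul]
    ring
  have hder := hK'.add ((((hd i).mul (hd i)).const_smul (a ^ 2)).add
    ((((hd (i + 1)).mul (hd (i + 1))).add ((hd (i + 2)).mul (hd (i + 2)))).const_smul (a ^ 2 / 2)))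
  rw [← h] at hder
  have h2 : dFun I (deformedPotential x a i K) m = _ := hder.mfderiv
  rw [h2]
  change dFun I K m X + (a ^ 2 * (x i m * dFun I (x i) m X + x i m * dFun I (x i) m X)
    + a ^ 2 / 2 * ((x (i + 1) m * dFun I (x (i + 1)) m X + x (i + 1) m * dFun I (x (i + 1)) m X)
    + (x (i + 2) m * dFun I (x (i + 2)) m X + x (i + 2) m * dFun I (x (i + 2)) m X))) = _
  ring

theorem dc_deformedPotential (hx : IsMomentMap hk A x) {i : Fin 3} {K : M → ℝ}
    (hK : ContMDiff I 𝓘(ℝ, ℝ) ∞ K) (hinv : A.Invariant K)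
    (hgen : ∀ m, dc I (hk.J i) K m (A.gen m) = 2 * x i m) (a : ℝ) (m : M)
    (X : TangentSpace I m) :
    dc I (deformedJ hk A x a i) (deformedPotential x a i K) m X
      = dc I (hk.J i) K m X + a ^ 2 * (x (i + 1) m * dFun I (x (i + 2)) m X
          - x (i + 2) m * dFun I (x (i + 1)) m X) := by
  have hN := (genNorm_pos hk A a m).ne'
  have hN' : hk.g.inner m (A.gen m) (A.gen m) * a ^ 2 = genNorm hk A a m - 1 := by
    unfold genNorm; ring
  have hdc : ∀ (J : ∀ m : M, TangentSpace I m →L[ℝ] TangentSpace I m) (f : M → ℝ)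
      (Y : TangentSpace I m), dc I J f m Y = -dFun I f m (J m Y) := fun J f Y => rfl
  have hT := hgen m
  rw [hdc] at hT
  have hT' : dFun I K m (hk.J i m (A.gen m)) = -(2 * x i m) := by linarith
  have hKT := hinv.dFun_gen (fun p => (hK p).mdifferentiableAt (by simp)) m
  rw [hdc, hdc, dFun_deformedPotential hK (fun j => (hx j).1), deformedJ_apply]
  simp only [map_sub, map_add, map_smul, smul_eq_mul, hx.dFun_gen, hx.dFun_J, hx.dFun_succ_J,
    hx.dFun_succ_succ_J, hT', hKT]
  field_simp
  linear_combination (-2 * a ^ 2 * x i m * hk.g.inner m (A.gen m) X) * hN'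

theorem IsMomentMap.invariant (hx : IsMomentMap hk A x) (i : Fin 3) : A.Invariant (x i) :=
  RAction.invariant_of_dFun_gen (fun p => ((hx i).1 p).mdifferentiableAt (by simp))
    (fun m => hx.dFun_gen m i)

theorem invariant_deformedPotential (hx : IsMomentMap hk A x) {K : M → ℝ} (hK : A.Invariant K)
    (a : ℝ) (i : Fin 3) : A.Invariant (deformedPotential x a i K) := by
  intro t m
  unfold deformedPotential
  rw [hK t m, hx.invariant i t m]
  simp only [hx.invariant _ t m]

theorem dc_deformedPotential_eq (hx : IsMomentMap hk A x) {i : Fin 3} {K : M → ℝ}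
    (hK : ContMDiff I 𝓘(ℝ, ℝ) ∞ K) (hinv : A.Invariant K)
    (hgen : ∀ m, dc I (hk.J i) K m (A.gen m) = 2 * x i m) (a : ℝ) :
    dc I (deformedJ hk A x a i) (deformedPotential x a i K)
      = fun p => dc I (hk.J i) K p + a ^ 2 • (x (i + 1) p • dFun I (x (i + 2)) p
          + (-x (i + 2) p) • dFun I (x (i + 1)) p) := by
  funext p
  ext X
  rw [dc_deformedPotential hx hK hinv hgen]
  simp only [add_apply, smul_apply, smul_eq_mul]
  ring

theorem formDifferentiableAt_dc_deformedPotential [I.Boundaryless] [FiniteDimensional ℝ E]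
    (hx : IsMomentMap hk A x) {i : Fin 3} {K : M → ℝ}
    (hK : ContMDiff I 𝓘(ℝ, ℝ) ∞ K) (hinv : A.Invariant K)
    (hgen : ∀ m, dc I (hk.J i) K m (A.gen m) = 2 * x i m) (a : ℝ) (m : M) :
    FormDifferentiableAt I (dc I (deformedJ hk A x a i) (deformedPotential x a i K)) m := by
  rw [dc_deformedPotential_eq hx hK hinv hgen]
  exact (formDifferentiableAt_dc hK (hk.smooth_J i) m).add
    ((dOne_smul_dFun_sub (hx (i + 1)).1 (hx (i + 2)).1 m).1.smul
      (contMDiff_const (c := a ^ 2)))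

theorem isKahlerPotential_deformedPotential [I.Boundaryless] [FiniteDimensional ℝ E]
    (hx : IsMomentMap hk A x) {i : Fin 3} {K : M → ℝ}
    (hK : IsKahlerPotential I hk.metric (hk.J i) K) (hinv : A.Invariant K)
    (hgen : ∀ m, dc I (hk.J i) K m (A.gen m) = 2 * x i m) (a : ℝ) :
    IsKahlerPotential I (deformedMetric hk A x a) (deformedJ hk A x a i)
      (deformedPotential x a i K) := by
  refine ⟨contMDiff_deformedPotential hK.1 (fun i => (hx i).1) a i, fun m X Y => ?_⟩
  have : IsManifold I 1 M := .of_le (n := ∞) (by simp)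
  obtain ⟨d2, h2⟩ := dOne_smul_dFun_sub (hx (i + 1)).1 (hx (i + 2)).1 m
  have d1 := formDifferentiableAt_dc hK.1 (hk.smooth_J i) m
  have ha : ContMDiff I 𝓘(ℝ, ℝ) ∞ (fun _ : M => a ^ 2) := contMDiff_const
  have hform := dc_deformedPotential_eq hx hK.1 hinv hgen a
  have hc : ∀ Z, dFun I (fun _ : M => a ^ 2) m Z = 0 := by
    intro Z
    have : mfderiv I 𝓘(ℝ, ℝ) (fun _ : M => a ^ 2) m = 0 := mfderiv_const
    unfold dFun
    rw [this]
    rfl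
  unfold ddc
  rw [hform, dOne_add I d1 (d2.smul ha), dOne_smul I ha d2, h2, hx.deformedMetric_J]
  have hK' := hK.2 m X Y
  unfold ddc at hK'
  unfold Hyperkahler.omega
  unfold Hyperkahler.metric at hK'
  rw [← hK']
  simp only [wedge, hc]
  ring

end DeformedPotential

/-- On a Kähler manifold, a homothetic gradient field `R` satisfies `L_R ω = 2 ω`. This is the
pointwise statement in a chart: `g`, `J`, `R` are the values and `G`, `B`, `D` the derivatives of
the metric, the complex structure and the field. -/
theorem kahler_homothety_algebra {V : Type*} [NormedAddCommGroup V] [NormedSpace ℝ V]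
    {g : V →L[ℝ] V →L[ℝ] ℝ} {J : V →L[ℝ] V} {R : V}
    {G : V →L[ℝ] V →L[ℝ] V →L[ℝ] ℝ} {B : V →L[ℝ] V →L[ℝ] V} {D : V →L[ℝ] V}
    (hJ : ∀ X, J (J X) = -X) (hg : ∀ X Y, g X Y = g Y X) (hω : ∀ X Y, g (J X) Y = -g (J Y) X)
    (hB : ∀ Z X, B Z (J X) = -J (B Z X)) (hG : ∀ Z X Y, G Z X Y = G Z Y X)
    (hΩ : ∀ Z X Y, G Z (J X) Y + g (B Z X) Y = -(G Z (J Y) X + g (B Z Y) X))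
    (hclosed : ∀ X Y Z, (G X (J Y) Z + g (B X Y) Z) + (G Y (J Z) X + g (B Y Z) X)
      + (G Z (J X) Y + g (B Z X) Y) = 0)
    (hN : ∀ X Y, B (J X) Y - B (J Y) X + J (B Y X) - J (B X Y) = 0)
    (hL : ∀ X Y, G R X Y + g (D X) Y + g X (D Y) = 2 * g X Y)
    (hgrad : ∀ X Y, G X R Y + g (D X) Y = G Y R X + g (D Y) X) (X Y : V) :
    (G X (J R) Y + g (B X R) Y + g (J (D X)) Y) - (G Y (J R) X + g (B Y R) X + g (J (D Y)) X)
      = 2 * g (J X) Y := by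
  obtain ⟨A, hA⟩ : ∃ A : V → V, ∀ X, A X = B R X - D (J X) + J (D X) := ⟨_, fun _ => rfl⟩
  obtain ⟨D', hD'⟩ : ∃ D' : V → V, ∀ X, D' X = B X R + J (D X) := ⟨_, fun _ => rfl⟩
  have hLω : ∀ X Y, G R (J X) Y + g (B R X) Y + g (J (D X)) Y + g (J X) (D Y)
      = 2 * g (J X) Y + g (A X) Y := by
    intro X Y
    have h := hL (J X) Y
    simp only [hA, map_sub, map_add, sub_apply, add_apply]
    linear_combination h
  have hanti : ∀ X Y, g (A X) Y = -g (A Y) X := by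
    intro X Y
    have h1 := hLω X Y
    have h2 := hLω Y X
    have h3 := hω (D X) Y
    have h4 := hω (D Y) X
    linear_combination -h1 - h2 + hΩ R X Y - 2 * hω X Y + h3 + h4
  have hcommute : ∀ X, J (A (J X)) = A X := by
    intro X
    simp only [hA, map_sub, map_add, hJ, hB, map_neg]
    abel
  have hA' : ∀ X, B (J R) X - D' (J X) + J (D' X) = J (A X) := by
    intro X
    have h := hN R X
    simp only [hA, hD', map_sub, map_add, hJ]
    have : B (J R) X = B (J X) R - J (B X R) + J (B R X) := by
      rw [← sub_eq_zero, ← h]; abel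
    rw [this]
    abel
  have hclosed' : ∀ X Y, (G X (J (J R)) Y + g (B X (J R)) Y + g (J (D' X)) Y)
      = (G Y (J (J R)) X + g (B Y (J R)) X + g (J (D' Y)) X) := by
    intro X Y
    have h := hgrad X Y
    simp only [hD', hJ, hB, map_add, map_neg, add_apply, neg_apply]
    linear_combination -h
  have hh : ∀ X Y, G (J R) (J X) Y + g (D' (J X)) Y + g (J X) (D' Y) = -g (J (A X)) Y := by
    intro X Y
    have h7 : g (B (J R) X) Y - g (D' (J X)) Y + g (J (D' X)) Y = g (J (A X)) Y := by
      rw [← hA' X, map_add, map_sub, add_apply, sub_apply]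
    linear_combination -h7 + hclosed X Y (J R) - hΩ X (J R) Y + hclosed' X Y + hω (D' Y) X
  have hneg : ∀ X, D' (-X) = -D' X := by
    intro X
    simp only [hD', map_neg, neg_apply]
    abel
  have hsymm : ∀ X Y, g (A X) Y = g (A Y) X := by
    intro X Y
    have h1 := hh (J X) Y
    have h2 := hh (J Y) X
    simp only [hcommute, hJ, map_neg, neg_apply, hneg] at h1 h2
    linear_combination h1 - h2 + hG (J R) X Y + hg (D' X) Y + hg X (D' Y)
  have hzero : g (A X) Y = 0 := by linarith [hanti X Y, hsymm X Y]
  linear_combination hLω X Y + hzero + hΩ X R Y - hclosed X Y R - hω (D Y) X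

section Bracket

variable {E : Type*} [NormedAddCommGroup E] [NormedSpace ℝ E] [FiniteDimensional ℝ E]
  {H : Type*} [TopologicalSpace H] {I : ModelWithCorners ℝ E H} [I.Boundaryless]
  {M : Type*} [TopologicalSpace M] [ChartedSpace H M] [IsManifold I ∞ M]

omit [FiniteDimensional ℝ E] in
theorem mlieBracket_eq_lieBracket {X Y : ∀ p : M, TangentSpace I p} {m : M} {V W : E → E}
    (hX : ∀ y ∈ (extChartAt I m).target, X ((extChartAt I m).symm y) = chartField I m (V y) y)
    (hY : ∀ y ∈ (extChartAt I m).target, Y ((extChartAt I m).symm y) = chartField I m (W y) y) :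
    VectorField.mlieBracket I X Y m = VectorField.lieBracket ℝ V W (extChartAt I m m) := by
  have : IsManifold I 1 M := .of_le (n := ∞) (by simp)
  have key : ∀ {X : ∀ p : M, TangentSpace I p} {V : E → E},
      (∀ y ∈ (extChartAt I m).target, X ((extChartAt I m).symm y) = chartField I m (V y) y) →
      VectorField.mpullbackWithin 𝓘(ℝ, E) I (extChartAt I m).symm X (Set.range I)
        =ᶠ[nhds (extChartAt I m m)] V := by
    intro X V hX
    filter_upwards [target_mem_nhds I m (mem_extChartAt_target m)] with y hy
    rw [VectorField.mpullbackWithin_apply, hX y hy]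
    rw [ContinuousLinearMap.inverse_eq
      (mfderivWithin_extChartAt_symm_comp_mfderiv_extChartAt (I := I) hy)
      (mfderiv_extChartAt_comp_mfderivWithin_extChartAt_symm (I := I) hy)]
    exact mfderiv_chart_chartField I m hy (V y)
  have hid : ∀ u : E, (mfderiv I 𝓘(ℝ, E) (extChartAt I m) m).inverse u = u := by
    intro u
    rw [mfderiv_extChartAt_self]
    change (ContinuousLinearMap.id ℝ E).inverse u = u
    rw [ContinuousLinearMap.inverse_id]
    rfl
  rw [← VectorField.mlieBracketWithin_univ, VectorField.mlieBracketWithin_apply]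
  refine (hid _).trans ?_
  rw [I.range_eq_univ, Set.preimage_univ, Set.univ_inter]
  rw [I.range_eq_univ] at key
  have h : ∀ V' W' : E → E, V' =ᶠ[nhds (extChartAt I m m)] V → W' =ᶠ[nhds (extChartAt I m m)] W →
      VectorField.lieBracketWithin ℝ V' W' Set.univ (extChartAt I m m)
        = VectorField.lieBracket ℝ V W (extChartAt I m m) := by
    intro V' W' hV hW
    rw [VectorField.lieBracketWithin_univ]
    exact Filter.EventuallyEq.lieBracket_vectorField_eq hV hW
  exact h _ _ (key hX) (key hY)

/-- The vanishing of the Nijenhuis tensor in a chart. -/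
theorem IsIntegrable.coord {J : ∀ m : M, TangentSpace I m →L[ℝ] TangentSpace I m}
    (hJ : ContMDiff I (I.prod 𝓘(ℝ, E →L[ℝ] E)) ∞
      (fun m => Bundle.TotalSpace.mk' (E →L[ℝ] E)
        (E := fun m : M => TangentSpace I m →L[ℝ] TangentSpace I m) m (J m)))
    (hN : IsIntegrable I J) (m : M) (v w : E) :
    let j := coordEndo I J m (extChartAt I m m)
    let b := fderiv ℝ (coordEndo I J m) (extChartAt I m m)
    b (j v) w - b (j w) v + j (b w v) - j (b v w) = 0 := by
  have : IsManifold I 1 M := .of_le (n := ∞) (by simp)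
  have h := hN m (fieldOfCoord I m (fun _ => v)) (fieldOfCoord I m (fun _ => w))
    (contMDiffAt_fieldOfCoord I m contDiffAt_const) (contMDiffAt_fieldOfCoord I m contDiffAt_const)
  have hc : ∀ u : E, ∀ y ∈ (extChartAt I m).target,
      fieldOfCoord I m (fun _ => u) ((extChartAt I m).symm y) = chartField I m u y :=
    fun u y hy => fieldOfCoord_symm I m _ hy
  have hcJ : ∀ u : E, ∀ y ∈ (extChartAt I m).target,
      J ((extChartAt I m).symm y) (fieldOfCoord I m (fun _ => u) ((extChartAt I m).symm y))
        = chartField I m (coordEndo I J m y u) y := by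
    intro u y hy
    rw [hc u y hy, chartField_coordEndo I J m hy]
  have hj : ∀ u : E, J m u = coordEndo I J m (extChartAt I m m) u := by
    intro u
    have h1 := eval_chartField_self I m (fun p X => mfderiv I 𝓘(ℝ, E) (extChartAt I m) p (J p X)) u
    exact (chartCoord_eq I m (J m u)).symm.trans h1.symm
  have hd := (contDiffAt_coordEndo I hJ m).differentiableAt (by simp)
  have hd' : ∀ u z : E, fderiv ℝ (fun y => coordEndo I J m y u) (extChartAt I m m) z
      = fderiv ℝ (coordEndo I J m) (extChartAt I m m) z u := by
    intro u z
    rw [fderiv_clm_apply hd (differentiableAt_const u)]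
    simp
  rw [mlieBracket_eq_lieBracket (hcJ v) (hcJ w), mlieBracket_eq_lieBracket (hcJ v) (hc w),
    mlieBracket_eq_lieBracket (hc v) (hcJ w), mlieBracket_eq_lieBracket (hc v) (hc w)] at h
  have h' : (VectorField.lieBracket ℝ (fun y => coordEndo I J m y v)
      (fun y => coordEndo I J m y w) (extChartAt I m m) : E)
    - coordEndo I J m (extChartAt I m m) (VectorField.lieBracket ℝ (fun y => coordEndo I J m y v)
      (fun _ => w) (extChartAt I m m))
    - coordEndo I J m (extChartAt I m m) (VectorField.lieBracket ℝ (fun _ => v)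
      (fun y => coordEndo I J m y w) (extChartAt I m m))
    - VectorField.lieBracket ℝ (fun _ => v) (fun _ => w) (extChartAt I m m) = 0 := by
    rw [← hj, ← hj]
    exact h
  simp only [VectorField.lieBracket, hd', fderiv_fun_const, Pi.zero_apply, zero_apply, zero_sub,
    sub_zero, map_neg] at h'
  rw [← h']
  intro j b
  simp only [j, b]
  abel

end Bracket

section KahlerChart

variable {E : Type*} [NormedAddCommGroup E] [NormedSpace ℝ E] [FiniteDimensional ℝ E]
  {H : Type*} [TopologicalSpace H] {I : ModelWithCorners ℝ E H} [I.Boundaryless]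
  {M : Type*} [TopologicalSpace M] [ChartedSpace H M] [IsManifold I ∞ M]

section Identities

variable (hk : Hyperkahler I M) (i : Fin 3) (m : M) {y : E}

omit [FiniteDimensional ℝ E] [I.Boundaryless]

theorem coordEndo_sq (hy : y ∈ (extChartAt I m).target) (v : E) :
    coordEndo I (hk.J i) m y (coordEndo I (hk.J i) m y v) = -v := by
  have : IsManifold I 1 M := .of_le (n := ∞) (by simp)
  have h : coordEndo I (hk.J i) m y (coordEndo I (hk.J i) m y v)
    = mfderiv I 𝓘(ℝ, E) (extChartAt I m) ((extChartAt I m).symm y)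
      (hk.J i _ (chartField I m (coordEndo I (hk.J i) m y v) y)) := rfl
  rw [h, chartField_coordEndo I _ m hy, hk.J_sq, map_neg]
  exact congrArg Neg.neg (mfderiv_chart_chartField I m hy v)

theorem coordBilin_symm (v w : E) :
    coordBilin I hk.g.inner m y v w = coordBilin I hk.g.inner m y w v := by
  rw [coordBilin_apply, coordBilin_apply, hk.g.symm]

theorem coordBilin_coordEndo (hy : y ∈ (extChartAt I m).target) (v w : E) :
    coordBilin I hk.g.inner m y (coordEndo I (hk.J i) m y v) w
      = hk.omega i _ (chartField I m v y) (chartField I m w y) := by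
  have : IsManifold I 1 M := .of_le (n := ∞) (by simp)
  rw [coordBilin_apply, chartField_coordEndo I _ m hy]
  rfl

theorem omega_antisymm (p : M) (X Y : TangentSpace I p) :
    hk.omega i p X Y = -hk.omega i p Y X := by
  unfold Hyperkahler.omega
  rw [hk.inner_J_left, hk.g.symm]

theorem coordBilin_coordEndo_antisymm (hy : y ∈ (extChartAt I m).target) (v w : E) :
    coordBilin I hk.g.inner m y (coordEndo I (hk.J i) m y v) w
      = -coordBilin I hk.g.inner m y (coordEndo I (hk.J i) m y w) v := by
  rw [coordBilin_coordEndo hk i m hy, coordBilin_coordEndo hk i m hy, omega_antisymm]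

end Identities

theorem hasFDerivAt_bilin_clm {V : Type*} [NormedAddCommGroup V] [NormedSpace ℝ V]
    {g : V → V →L[ℝ] V →L[ℝ] ℝ} {J : V → V →L[ℝ] V} {R : V → V} {y : V}
    (hg : DifferentiableAt ℝ g y) (hJ : DifferentiableAt ℝ J y) (hR : DifferentiableAt ℝ R y)
    (w Z : V) :
    DifferentiableAt ℝ (fun y => g y (J y (R y)) w) y ∧
    fderiv ℝ (fun y => g y (J y (R y)) w) y Z = fderiv ℝ g y Z (J y (R y)) w
      + g y (fderiv ℝ J y Z (R y)) w + g y (J y (fderiv ℝ R y Z)) w := by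
  have h1 := hJ.hasFDerivAt.clm_apply hR.hasFDerivAt
  have h2 := (hg.hasFDerivAt.clm_apply h1).clm_apply (hasFDerivAt_const w y)
  refine ⟨h2.differentiableAt, ?_⟩
  rw [h2.fderiv]
  simp [ContinuousLinearMap.flip_apply]
  ring

variable (hk : Hyperkahler I M) (i : Fin 3) (m : M)

theorem differentiableAt_coordBilin :
    DifferentiableAt ℝ (coordBilin I hk.g.inner m) (extChartAt I m m) :=
  (contDiffAt_coordBilin I hk.g m).differentiableAt (by simp)

theorem differentiableAt_coordEndo :
    DifferentiableAt ℝ (coordEndo I (hk.J i) m) (extChartAt I m m) :=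
  (contDiffAt_coordEndo I (hk.smooth_J i) m).differentiableAt (by simp)

theorem fderiv_coord_omega (v w Z : E) :
    fderiv ℝ (fun y => coordBilin I hk.g.inner m y (coordEndo I (hk.J i) m y v) w)
      (extChartAt I m m) Z
    = fderiv ℝ (coordBilin I hk.g.inner m) (extChartAt I m m) Z
        (coordEndo I (hk.J i) m (extChartAt I m m) v) w
      + coordBilin I hk.g.inner m (extChartAt I m m)
        (fderiv ℝ (coordEndo I (hk.J i) m) (extChartAt I m m) Z v) w := by
  have h := (hasFDerivAt_bilin_clm (differentiableAt_coordBilin hk m)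
    (differentiableAt_coordEndo hk i m) (differentiableAt_const v) w Z).2
  simpa using h

theorem closed_coord (X Y Z : E) :
    let g := coordBilin I hk.g.inner m (extChartAt I m m)
    let J := coordEndo I (hk.J i) m (extChartAt I m m)
    let G := fderiv ℝ (coordBilin I hk.g.inner m) (extChartAt I m m)
    let B := fderiv ℝ (coordEndo I (hk.J i) m) (extChartAt I m m)
    (G X (J Y) Z + g (B X Y) Z) + (G Y (J Z) X + g (B Y Z) X) + (G Z (J X) Y + g (B Z X) Y)
      = 0 := by
  have : IsManifold I 1 M := .of_le (n := ∞) (by simp)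
  intro g J G B
  have hc : ∀ Z : E, chartCoord I m Z = Z := fun Z => chartCoord_eq I m Z
  have key : ∀ X Y Z : E, derivTwo I (fun p => (hk.g.inner p).comp (hk.J i p)) m X Y Z
      = G X (J Y) Z + g (B X Y) Z := by
    intro X Y Z
    rw [← fderiv_coord_omega hk i m Y Z X]
    unfold derivTwo
    rw [hc, hc, hc, I.range_eq_univ, fderivWithin_univ]
    refine congrArg (fun L : E →L[ℝ] ℝ => L X) (Filter.EventuallyEq.fderiv_eq ?_)
    filter_upwards [target_mem_nhds I m (mem_extChartAt_target m)] with y hy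
    rw [coordBilin_coordEndo hk i m hy]
    rfl
  have h := hk.closed i m X Y Z
  unfold dTwo at h
  rwa [key X Y Z, key Y Z X, key Z X Y] at h

/-- If the gradient `R` of `ψ` satisfies `L_R g = 2 g` then `dd^c ψ = 2 ω`. -/
theorem ddc_eq_of_homothety {R : E → E} {ψ : M → ℝ} (hψ : ContMDiff I 𝓘(ℝ, ℝ) ∞ ψ)
    (hR : DifferentiableAt ℝ R (extChartAt I m m))
    (hgrad : ∀ᶠ y in nhds (extChartAt I m m), ∀ v,
      fderiv ℝ (coordFun I ψ m) y v = coordBilin I hk.g.inner m y (R y) v)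
    (hL : ∀ X Y, fderiv ℝ (coordBilin I hk.g.inner m) (extChartAt I m m)
        (R (extChartAt I m m)) X Y
      + coordBilin I hk.g.inner m (extChartAt I m m) (fderiv ℝ R (extChartAt I m m) X) Y
      + coordBilin I hk.g.inner m (extChartAt I m m) X (fderiv ℝ R (extChartAt I m m) Y)
      = 2 * coordBilin I hk.g.inner m (extChartAt I m m) X Y) :
    ∀ X Y : TangentSpace I m, ddc I (hk.J i) ψ m X Y = 2 * hk.omega i m X Y := by
  have : IsManifold I 1 M := .of_le (n := ∞) (by simp)
  intro (X : E) (Y : E)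
  have ht := target_mem_nhds I m (mem_extChartAt_target (I := I) m)
  have hy0 := mem_extChartAt_target (I := I) m
  have hg := differentiableAt_coordBilin hk m
  have hJ := differentiableAt_coordEndo hk i m
  have hform : ∀ v : E, coordForm I (dc I (hk.J i) ψ) m v =ᶠ[nhds (extChartAt I m m)]
      fun y => coordBilin I hk.g.inner m y (coordEndo I (hk.J i) m y (R y)) v := by
    intro v
    filter_upwards [coordForm_dc_eventuallyEq hψ (hk.J i) m v, hgrad, ht] with y h1 h2 hy
    rw [h1, h2, coordBilin_symm, ← coordBilin_coordEndo_antisymm hk i m hy]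
  have hsnd : ∀ X Y : E,
      fderiv ℝ (coordBilin I hk.g.inner m) (extChartAt I m m) X (R (extChartAt I m m)) Y
      + coordBilin I hk.g.inner m (extChartAt I m m) (fderiv ℝ R (extChartAt I m m) X) Y
      = fderiv ℝ (coordBilin I hk.g.inner m) (extChartAt I m m) Y (R (extChartAt I m m)) X
      + coordBilin I hk.g.inner m (extChartAt I m m) (fderiv ℝ R (extChartAt I m m) Y) X := by
    have key : ∀ v Z : E, fderiv ℝ (fun y => fderiv ℝ (coordFun I ψ m) y v) (extChartAt I m m) Z
        = fderiv ℝ (coordBilin I hk.g.inner m) (extChartAt I m m) Z (R (extChartAt I m m)) v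
      + coordBilin I hk.g.inner m (extChartAt I m m) (fderiv ℝ R (extChartAt I m m) Z) v := by
      intro v Z
      have h := (hg.hasFDerivAt.clm_apply hR.hasFDerivAt).clm_apply
        (hasFDerivAt_const v (extChartAt I m m))
      rw [(show (fun y => fderiv ℝ (coordFun I ψ m) y v) =ᶠ[nhds (extChartAt I m m)] _ from
        hgrad.mono fun y hy => hy v).fderiv_eq, h.fderiv]
      simp [ContinuousLinearMap.flip_apply]
      ring
    have hc := contDiffAt_coordFun I m hy0 (hψ ((extChartAt I m).symm _))
    have hd := (hc.fderiv_right (m := 1) (by norm_cast)).differentiableAt (by simp)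
    have hs := hc.isSymmSndFDerivAt (by simp; norm_cast)
    intro X Y
    rw [← key Y X, ← key X Y, fderiv_clm_apply hd (differentiableAt_const _),
      fderiv_clm_apply hd (differentiableAt_const _)]
    simpa using hs.eq X Y
  unfold ddc
  rw [dOne_eq, (hform Y).fderiv_eq, (hform X).fderiv_eq,
    (hasFDerivAt_bilin_clm hg hJ hR Y X).2, (hasFDerivAt_bilin_clm hg hJ hR X Y).2]
  have hω0 : hk.omega i m X Y = coordBilin I hk.g.inner m (extChartAt I m m)
      (coordEndo I (hk.J i) m (extChartAt I m m) X) Y := by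
    rw [coordBilin_coordEndo hk i m hy0]
    exact (eval_chartField_self₂ I m (fun p => hk.omega i p) X Y).symm
  rw [hω0]
  refine kahler_homothety_algebra (fun X => coordEndo_sq hk i m hy0 X)
    (fun X Y => coordBilin_symm hk m X Y)
    (fun X Y => coordBilin_coordEndo_antisymm hk i m hy0 X Y) ?_ ?_ ?_ (closed_coord hk i m)
    ((hk.integrable i).coord (hk.smooth_J i) m) hL hsnd X Y
  · intro Z X
    have h := hJ.hasFDerivAt.clm_apply (hJ.hasFDerivAt.clm_apply
      (hasFDerivAt_const X (extChartAt I m m)))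
    have h0 : (fun y => coordEndo I (hk.J i) m y (coordEndo I (hk.J i) m y X))
        =ᶠ[nhds (extChartAt I m m)] fun _ => -X := by
      filter_upwards [ht] with y hy using coordEndo_sq hk i m hy X
    have h1 := h.unique ((hasFDerivAt_const (-X) _).congr_of_eventuallyEq h0)
    have h2 := congrArg (fun L : E →L[ℝ] E => L Z) h1
    simp [ContinuousLinearMap.flip_apply] at h2
    rw [eq_neg_iff_add_eq_zero, add_comm]
    exact h2
  · intro Z X Y
    have key : ∀ X Y : E, fderiv ℝ (fun y => coordBilin I hk.g.inner m y X Y) (extChartAt I m m) Z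
        = fderiv ℝ (coordBilin I hk.g.inner m) (extChartAt I m m) Z X Y := by
      intro X Y
      have h := (hg.hasFDerivAt.clm_apply (hasFDerivAt_const X (extChartAt I m m))).clm_apply
        (hasFDerivAt_const Y (extChartAt I m m))
      rw [h.fderiv]
      simp [ContinuousLinearMap.flip_apply]
    rw [← key X Y, ← key Y X]
    simp only [coordBilin_symm hk m X Y]
  · intro Z X Y
    rw [← fderiv_coord_omega, ← fderiv_coord_omega]
    have h0 : (fun y => coordBilin I hk.g.inner m y (coordEndo I (hk.J i) m y X) Y)
        =ᶠ[nhds (extChartAt I m m)]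
        fun y => -coordBilin I hk.g.inner m y (coordEndo I (hk.J i) m y Y) X := by
      filter_upwards [ht] with y hy using coordBilin_coordEndo_antisymm hk i m hy X Y
    rw [h0.fderiv_eq, fderiv_fun_neg]
    rfl

end KahlerChart

section Flow

variable {E : Type*} [NormedAddCommGroup E] [NormedSpace ℝ E]
  {H : Type*} [TopologicalSpace H] {I : ModelWithCorners ℝ E H} [I.Boundaryless]
  {M : Type*} [TopologicalSpace M] [ChartedSpace H M] [IsManifold I ∞ M]

omit [I.Boundaryless] [IsManifold I ∞ M] in
theorem contMDiffAt_of_coordFun {f : M → ℝ} {m : M}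
    (h : ContDiffAt ℝ ∞ (coordFun I f m) (extChartAt I m m)) :
    ContMDiffAt I 𝓘(ℝ, ℝ) ∞ f m := by
  have hc : ContMDiffAt I 𝓘(ℝ, ℝ) ∞ (coordFun I f m ∘ extChartAt I m) m :=
    h.contMDiffAt.comp m contMDiffAt_extChartAt
  refine hc.congr_of_eventuallyEq ?_
  filter_upwards [extChartAt_source_mem_nhds (I := I) m] with p hp
  simp only [Function.comp, coordFun]
  rw [(extChartAt I m).left_inv hp]

/-- The flow read in the preferred chart at `m`. -/
def coordFlow (A : RAction I M) (m : M) (p : ℝ × E) : E :=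
  extChartAt I m (A.act p.1 ((extChartAt I m).symm p.2))

variable (A : RAction I M) (m : M)

theorem contDiffAt_coordFlow :
    ContDiffAt ℝ ∞ (coordFlow A m) ((0 : ℝ), extChartAt I m m) := by
  have hy0 := mem_extChartAt_target (I := I) m
  have h1 : ContMDiffAt 𝓘(ℝ, ℝ × E) (𝓘(ℝ, ℝ).prod I) ∞
      (fun p : ℝ × E => (p.1, (extChartAt I m).symm p.2)) ((0 : ℝ), extChartAt I m m) := by
    refine ContMDiffAt.prodMk contDiff_fst.contMDiff.contMDiffAt ?_
    exact ContMDiffAt.comp (I' := 𝓘(ℝ, E)) _ (contMDiffAt_chart_symm I m hy0)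
      contDiff_snd.contMDiff.contMDiffAt
  have h2 := (A.smooth.contMDiffAt (x := ((0 : ℝ), (extChartAt I m).symm (extChartAt I m m)))).comp
    ((0 : ℝ), extChartAt I m m) h1
  have h3 : ContMDiffAt I 𝓘(ℝ, E) ∞ (extChartAt I m)
      (A.act 0 ((extChartAt I m).symm (extChartAt I m m))) := by
    rw [A.zero_act, extChartAt_to_inv]
    exact contMDiffAt_extChartAt
  exact (h3.comp ((0 : ℝ), extChartAt I m m) h2).contDiffAt

omit [I.Boundaryless] [IsManifold I ∞ M] in
theorem coordFlow_zero {y : E} (hy : y ∈ (extChartAt I m).target) :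
    coordFlow A m (0, y) = y := by
  simp only [coordFlow, A.zero_act]
  exact (extChartAt I m).right_inv hy

theorem eventually_differentiableAt_coordFlow :
    ∀ᶠ p in nhds ((0 : ℝ), extChartAt I m m), DifferentiableAt ℝ (coordFlow A m) p := by
  have h := ((contDiffAt_coordFlow A m).of_le (m := 1) (by norm_cast)).eventually (by simp)
  filter_upwards [h] with p hp using hp.differentiableAt (by simp)

omit [I.Boundaryless] [IsManifold I ∞ M] in
theorem contMDiff_act (t : ℝ) : ContMDiff I I ∞ (A.act t) :=
  A.smooth.comp (contMDiff_const.prodMk contMDiff_id)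

/-- The generator in the chart is the time derivative of the flow. -/
theorem coordField_gen_eventuallyEq :
    coordField I A.gen m =ᶠ[nhds (extChartAt I m m)]
      fun y => fderiv ℝ (coordFlow A m) (0, y) (1, 0) := by
  have : IsManifold I 1 M := .of_le (n := ∞) (by simp)
  have ht := target_mem_nhds I m (mem_extChartAt_target (I := I) m)
  have hd : ∀ᶠ y in nhds (extChartAt I m m), DifferentiableAt ℝ (coordFlow A m) ((0 : ℝ), y) :=
    (Continuous.prodMk_right (0 : ℝ)).continuousAt.eventually
      (eventually_differentiableAt_coordFlow A m)
  filter_upwards [ht, hd] with y hy hdy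
  set q := (extChartAt I m).symm y with hq
  have hqs : q ∈ (extChartAt I m).source := (extChartAt I m).map_target hy
  have hqs' : q ∈ (chartAt H m).source := by rwa [extChartAt_source] at hqs
  have h1 : MDifferentiableAt 𝓘(ℝ, ℝ) I (fun s : ℝ => A.act s q) 0 :=
    (A.contMDiff_orbit q _).mdifferentiableAt (by simp)
  have h2 : MDifferentiableAt I 𝓘(ℝ, E) (extChartAt I m) (A.act 0 q) := by
    rw [A.zero_act]
    exact mdifferentiableAt_extChartAt hqs'
  have h3 := mfderiv_comp (0 : ℝ) h2 h1
  have h4 : HasFDerivAt (fun s : ℝ => coordFlow A m (s, y))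
      ((fderiv ℝ (coordFlow A m) (0, y)).comp (ContinuousLinearMap.inl ℝ ℝ E)) 0 :=
    HasFDerivAt.comp (g := coordFlow A m) (0 : ℝ) hdy.hasFDerivAt
      (hasFDerivAt_prodMk_left (𝕜 := ℝ) (0 : ℝ) y)
  have h5 : mfderiv 𝓘(ℝ, ℝ) 𝓘(ℝ, E) (extChartAt I m ∘ fun s : ℝ => A.act s q) 0
      = (fderiv ℝ (coordFlow A m) (0, y)).comp (ContinuousLinearMap.inl ℝ ℝ E) := by
    rw [mfderiv_eq_fderiv]
    exact h4.fderiv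
  have key : ∀ (p : M) (_ : p = q) (w : TangentSpace I p), (w : E) = A.gen q →
      (mfderiv I 𝓘(ℝ, E) (extChartAt I m) p w : E)
        = mfderiv I 𝓘(ℝ, E) (extChartAt I m) q (A.gen q) := by
    rintro p rfl w h
    exact congrArg (mfderiv I 𝓘(ℝ, E) (extChartAt I m) q) h
  have h6 := key _ (A.zero_act q) (mfderiv 𝓘(ℝ, ℝ) I (fun t : ℝ => A.act t q) 0 (1 : ℝ)) rfl
  have h7 : (fderiv ℝ (coordFlow A m) (0, y)).comp (ContinuousLinearMap.inl ℝ ℝ E) (1 : ℝ)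
      = mfderiv I 𝓘(ℝ, E) (extChartAt I m) (A.act 0 q)
        (mfderiv 𝓘(ℝ, ℝ) I (fun t : ℝ => A.act t q) 0 (1 : ℝ)) := by
    rw [← h5]
    exact congrArg (fun L : ℝ →L[ℝ] E => L 1) h3
  exact (h7.trans h6).symm

theorem contDiffAt_coordField_gen :
    ContDiffAt ℝ ∞ (coordField I A.gen m) (extChartAt I m m) := by
  refine ContDiffAt.congr_of_eventuallyEq ?_ (coordField_gen_eventuallyEq A m)
  have h := (contDiffAt_coordFlow A m).fderiv_right (m := ∞) (by simp)
  have h2 : ContDiffAt ℝ ∞ (fun y : E => ((0 : ℝ), y)) (extChartAt I m m) :=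
    contDiffAt_const.prodMk contDiffAt_id
  exact (ContDiffAt.comp (extChartAt I m m) h h2).clm_apply contDiffAt_const

/-- The space derivative of the flow in the chart computes invariant forms. -/
theorem eventually_coordForm_coordFlow {α : ∀ m : M, TangentSpace I m →L[ℝ] ℝ}
    (hα : ∀ t m X, α (A.act t m) (mfderiv I I (A.act t) m X) = α m X) (v : E) :
    ∀ᶠ t in nhds (0 : ℝ), coordForm I α m
      (fderiv ℝ (coordFlow A m) (t, extChartAt I m m) (0, v))
      (coordFlow A m (t, extChartAt I m m)) = α m v := by
  have : IsManifold I 1 M := .of_le (n := ∞) (by simp)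
  have hd : ∀ᶠ t in nhds (0 : ℝ),
      DifferentiableAt ℝ (coordFlow A m) (t, extChartAt I m m) :=
    (Continuous.prodMk_left (extChartAt I m m)).continuousAt.eventually
      (eventually_differentiableAt_coordFlow A m)
  have hs : ∀ᶠ t in nhds (0 : ℝ), A.act t m ∈ (extChartAt I m).source := by
    have hc : ContinuousAt (fun s => A.act s m) 0 := (A.contMDiff_orbit m).continuous.continuousAt
    rw [ContinuousAt, A.zero_act] at hc
    exact hc.eventually (extChartAt_source_mem_nhds m)
  filter_upwards [hd, hs] with t hdt hst
  have hst' : A.act t m ∈ (chartAt H m).source := by rwa [extChartAt_source] at hst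
  set y0 := extChartAt I m m with hy0
  have hty0 : y0 ∈ (extChartAt I m).target := mem_extChartAt_target m
  have he : (extChartAt I m).symm y0 = m := extChartAt_to_inv m
  have h4 : HasFDerivAt (fun y : E => coordFlow A m (t, y))
      ((fderiv ℝ (coordFlow A m) (t, y0)).comp (ContinuousLinearMap.inr ℝ ℝ E)) y0 :=
    hdt.hasFDerivAt.comp y0 (hasFDerivAt_prodMk_right t y0)
  have h1 : MDifferentiableAt 𝓘(ℝ, E) I (extChartAt I m).symm y0 :=
    mdifferentiableAt_chart_symm I m hty0
  have h2 : MDifferentiableAt I I (A.act t) ((extChartAt I m).symm y0) :=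
    (contMDiff_act A t _).mdifferentiableAt (by simp)
  have h3 : MDifferentiableAt I 𝓘(ℝ, E) (extChartAt I m)
      (A.act t ((extChartAt I m).symm y0)) := by
    rw [he]
    exact mdifferentiableAt_extChartAt hst'
  have h5 := mfderiv_comp y0 h3 (h2.comp y0 h1)
  have h6 := mfderiv_comp y0 h2 h1
  have h7 : mfderiv 𝓘(ℝ, E) 𝓘(ℝ, E)
      (extChartAt I m ∘ (A.act t ∘ (extChartAt I m).symm)) y0
      = (fderiv ℝ (coordFlow A m) (t, y0)).comp (ContinuousLinearMap.inr ℝ ℝ E) := by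
    rw [mfderiv_eq_fderiv]
    exact h4.fderiv
  set p := A.act t ((extChartAt I m).symm y0) with hp
  have hps : p ∈ (extChartAt I m).source := by rw [hp, he]; exact hst
  obtain ⟨w, hw⟩ : ∃ w : TangentSpace I ((extChartAt I m).symm y0),
      w = mfderiv 𝓘(ℝ, E) I (extChartAt I m).symm y0 v := ⟨_, rfl⟩
  have hD : fderiv ℝ (coordFlow A m) (t, y0) (0, v)
      = mfderiv I 𝓘(ℝ, E) (extChartAt I m) p
        (mfderiv I I (A.act t) ((extChartAt I m).symm y0) w) := by
    have h8 : (fderiv ℝ (coordFlow A m) (t, y0)).comp (ContinuousLinearMap.inr ℝ ℝ E) v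
        = fderiv ℝ (coordFlow A m) (t, y0) (0, v) := rfl
    rw [← h8, ← h7, hw]
    have h9 := congrArg (fun L : E →L[ℝ] E => L v) h5
    refine h9.trans ?_
    exact congrArg (mfderiv I 𝓘(ℝ, E) (extChartAt I m) p)
      (congrArg (fun L : E →L[ℝ] TangentSpace I p => L v) h6)
  have key : ∀ (q : M) (_ : q = p) (u : TangentSpace I q),
      (u : E) = mfderiv I I (A.act t) ((extChartAt I m).symm y0) w → α q u = α m v := by
    rintro q rfl u hu
    have h8 : u = mfderiv I I (A.act t) ((extChartAt I m).symm y0) w := hu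
    rw [h8, hα, hw, ← chartField_eq]
    exact coordForm_self I α m v
  refine key _ ((extChartAt I m).left_inv hps) _ ?_
  rw [hD]
  exact congrArg (fun L : E →L[ℝ] E => L (mfderiv I I (A.act t) ((extChartAt I m).symm y0) w))
    (mfderivWithin_extChartAt_symm_comp_mfderiv_extChartAt' (I := I) hps)

/-- Cartan's formula for a form invariant under the flow: `d(α(T)) = -ι_T dα`. -/
theorem dFun_apply_gen_of_invariant {α : ∀ m : M, TangentSpace I m →L[ℝ] ℝ}
    (hα : ∀ t m X, α (A.act t m) (mfderiv I I (A.act t) m X) = α m X)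
    {a : E → E →L[ℝ] ℝ} (ha : DifferentiableAt ℝ a (extChartAt I m m))
    (haα : ∀ y ∈ (extChartAt I m).target, ∀ v, coordForm I α m v y = a y v)
    (hf : MDifferentiableAt I 𝓘(ℝ, ℝ) (fun p => α p (A.gen p)) m) :
    ∀ X : TangentSpace I m,
      dFun I (fun p => α p (A.gen p)) m X = -dOne I α m (A.gen m) X := by
  have : IsManifold I 1 M := .of_le (n := ∞) (by simp)
  intro (X : E)
  have ht := target_mem_nhds I m (mem_extChartAt_target (I := I) m)
  set y0 := extChartAt I m m with hy0
  have hty0 : y0 ∈ (extChartAt I m).target := mem_extChartAt_target m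
  have hT : (A.gen m : E) = coordField I A.gen m y0 := by
    have h1 := eval_chartField_self I m
      (fun p X => mfderiv I 𝓘(ℝ, E) (extChartAt I m) p (A.gen p)) (A.gen m)
    exact (chartCoord_eq I m (A.gen m)).symm.trans h1.symm
  have hTd := (contDiffAt_coordField_gen A m).differentiableAt (by simp)
  have hfun : coordFun I (fun p => α p (A.gen p)) m =ᶠ[nhds y0]
      fun y => a y (coordField I A.gen m y) := by
    filter_upwards [ht] with y hy
    rw [← haα y hy]
    unfold coordFun coordForm
    rw [chartField_coordField I A.gen m hy]
  have hform : ∀ v, coordForm I α m v =ᶠ[nhds y0] fun y => a y v := by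
    intro v
    filter_upwards [ht] with y hy using haα y hy v
  have hav : ∀ v Z : E, fderiv ℝ (fun y => a y v) y0 Z = fderiv ℝ a y0 Z v := by
    intro v Z
    rw [fderiv_clm_apply ha (differentiableAt_const v)]
    simp
  have hF : ContDiffAt ℝ ∞ (coordFlow A m) ((0 : ℝ), y0) := contDiffAt_coordFlow A m
  have hFd := (hF.fderiv_right (m := 1) (by norm_cast)).differentiableAt (by simp)
  have hFs := hF.isSymmSndFDerivAt (by simp; norm_cast)
  have hF0 := hF.differentiableAt (by simp)
  have hDT : fderiv ℝ (coordField I A.gen m) y0 X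
      = fderiv ℝ (fderiv ℝ (coordFlow A m)) (0, y0) (0, X) (1, 0) := by
    rw [(coordField_gen_eventuallyEq A m).fderiv_eq]
    have h := (hFd.hasFDerivAt.comp y0 (hasFDerivAt_prodMk_right (0 : ℝ) y0)).clm_apply
      (hasFDerivAt_const ((1 : ℝ), (0 : E)) y0)
    have h' : fderiv ℝ (fun y => fderiv ℝ (coordFlow A m) (0, y) (1, 0)) y0 = _ := h.fderiv
    rw [h']
    simp only [add_apply, ContinuousLinearMap.flip_apply, ContinuousLinearMap.comp_apply,
      zero_apply, map_zero, ContinuousLinearMap.inr_apply, zero_add]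
  have hspace : fderiv ℝ (coordFlow A m) (0, y0) (0, X) = X := by
    have h1 : HasFDerivAt (fun y => coordFlow A m (0, y)) _ y0 :=
      hF0.hasFDerivAt.comp y0 (hasFDerivAt_prodMk_right (0 : ℝ) y0)
    have h2 : (fun y => coordFlow A m (0, y)) =ᶠ[nhds y0] fun y => y := by
      filter_upwards [ht] with y hy using coordFlow_zero A m hy
    have h3 := h1.unique ((hasFDerivAt_id y0).congr_of_eventuallyEq h2)
    exact congrArg (fun L : E →L[ℝ] E => L X) h3
  have htime : fderiv ℝ (coordFlow A m) (0, y0) (1, 0) = coordField I A.gen m y0 :=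
    (coordField_gen_eventuallyEq A m).self_of_nhds.symm
  have hF00 : coordFlow A m (0, y0) = y0 := coordFlow_zero A m hty0
  have hLie : fderiv ℝ a y0 (coordField I A.gen m y0) X
      + a y0 (fderiv ℝ (coordField I A.gen m) y0 X) = 0 := by
    have hcurve : HasFDerivAt (fun t : ℝ => ((t, y0) : ℝ × E)) _ 0 :=
      hasFDerivAt_prodMk_left (𝕜 := ℝ) (0 : ℝ) y0
    have ha' : HasFDerivAt a (fderiv ℝ a y0) (coordFlow A m (0, y0)) := by
      rw [hF00]; exact ha.hasFDerivAt
    have h1 := ha'.comp (0 : ℝ) (hF0.hasFDerivAt.comp (0 : ℝ) hcurve)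
    have h2 := (hFd.hasFDerivAt.comp (0 : ℝ) hcurve).clm_apply
      (hasFDerivAt_const ((0 : ℝ), X) (0 : ℝ))
    have h3 := h1.clm_apply h2
    have hc : (fun t : ℝ => a (coordFlow A m (t, y0)) (fderiv ℝ (coordFlow A m) (t, y0) (0, X)))
        =ᶠ[nhds 0] fun _ => α m X := by
      have hnt : ∀ᶠ t in nhds (0 : ℝ), coordFlow A m (t, y0) ∈ (extChartAt I m).target := by
        have hcont : ContinuousAt (fun t : ℝ => coordFlow A m (t, y0)) 0 :=
          (HasFDerivAt.comp (g := coordFlow A m) (0 : ℝ) hF0.hasFDerivAt hcurve).continuousAt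
        rw [ContinuousAt, hF00] at hcont
        exact hcont.eventually ht
      filter_upwards [eventually_coordForm_coordFlow A m hα X, hnt] with t h1 h2
      rw [← haα _ h2]
      exact h1
    have h4 := h3.unique ((hasFDerivAt_const (α m X) (0 : ℝ)).congr_of_eventuallyEq hc)
    have h5 := congrArg (fun L : ℝ →L[ℝ] ℝ => L 1) h4
    simp only [Function.comp] at h5
    simp [ContinuousLinearMap.flip_apply, hF00, htime, hspace] at h5
    rw [hDT, hFs.eq (0, X) (1, 0)]
    linarith
  rw [dFun_apply_eq I m hf X, hfun.fderiv_eq, hT]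
  rw [dOne_eq, (hform X).fderiv_eq, (hform _).fderiv_eq, hav, hav,
    fderiv_clm_apply ha hTd]
  simp [ContinuousLinearMap.flip_apply]
  linarith

end Flow

section PotentialMoment

variable {E : Type*} [NormedAddCommGroup E] [NormedSpace ℝ E] [FiniteDimensional ℝ E]
  {H : Type*} [TopologicalSpace H] {I : ModelWithCorners ℝ E H} [I.Boundaryless]
  {M : Type*} [TopologicalSpace M] [ChartedSpace H M] [IsManifold I ∞ M]
  {hk : Hyperkahler I M} {A : RAction I M} {ψ : M → ℝ}

omit [FiniteDimensional ℝ E] [I.Boundaryless] in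
theorem dc_invariant (hA : A.Preserves hk) (hψ : ContMDiff I 𝓘(ℝ, ℝ) ∞ ψ)
    (hinv : A.Invariant ψ) (i : Fin 3) (t : ℝ) (m : M) (X : TangentSpace I m) :
    dc I (hk.J i) ψ (A.act t m) (mfderiv I I (A.act t) m X) = dc I (hk.J i) ψ m X := by
  have hcomp : ψ ∘ A.act t = ψ := funext fun p => hinv t p
  have h := mfderiv_comp m ((hψ (A.act t m)).mdifferentiableAt (by simp))
    ((contMDiff_act A t m).mdifferentiableAt (by simp))
  rw [hcomp] at h
  have h1 : ∀ Y : TangentSpace I m, dFun I ψ m Y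
      = dFun I ψ (A.act t m) (mfderiv I I (A.act t) m Y) := fun Y =>
    congrArg (fun L : TangentSpace I m →L[ℝ] ℝ => L Y) h
  change -dFun I ψ (A.act t m) (hk.J i (A.act t m) (mfderiv I I (A.act t) m X))
    = -dFun I ψ m (hk.J i m X)
  rw [(hA t m X).2 i, ← h1]

theorem contMDiff_dc_gen (hk : Hyperkahler I M) (A : RAction I M)
    (hψ : ContMDiff I 𝓘(ℝ, ℝ) ∞ ψ) (i : Fin 3) :
    ContMDiff I 𝓘(ℝ, ℝ) ∞ (fun p => dc I (hk.J i) ψ p (A.gen p)) := by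
  have : IsManifold I 1 M := .of_le (n := ∞) (by simp)
  intro m
  apply contMDiffAt_of_coordFun
  have h0 := contDiffAt_coordFun I m (mem_extChartAt_target m) (hψ ((extChartAt I m).symm _))
  have h1 := h0.fderiv_right (m := ∞) (by simp)
  have h2 := contDiffAt_coordEndo I (hk.smooth_J i) m
  have h3 := contDiffAt_coordField_gen A m
  refine ContDiffAt.congr_of_eventuallyEq (h1.clm_apply (h2.clm_apply h3)).neg ?_
  filter_upwards [target_mem_nhds I m (mem_extChartAt_target m)] with y hy
  rw [← coordForm_dc hψ (hk.J i) m (coordField I A.gen m y) hy]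
  unfold coordFun coordForm
  rw [chartField_coordField I A.gen m hy]

/-- An invariant common Kähler potential `ψ` gives the moment map `½ d^c_{I_i} ψ(T)`. -/
theorem isMomentMap_of_potential (hA : A.Preserves hk) (hinv : A.Invariant ψ)
    (hψ : ∀ i, IsKahlerPotential I hk.metric (hk.J i) ψ) :
    IsMomentMap hk A (fun i p => (1 / 2 : ℝ) * dc I (hk.J i) ψ p (A.gen p)) := by
  intro i
  have hs := contMDiff_dc_gen hk A (hψ i).1 i
  refine ⟨contMDiff_const.mul hs, fun m X => ?_⟩
  have hsm : MDifferentiableAt I 𝓘(ℝ, ℝ) (fun p => dc I (hk.J i) ψ p (A.gen p)) m :=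
    (hs m).mdifferentiableAt (by simp)
  have h0 := contDiffAt_coordFun I m (mem_extChartAt_target m) ((hψ i).1 ((extChartAt I m).symm _))
  have h1 := (h0.fderiv_right (m := 1) (by norm_cast)).differentiableAt (by simp)
  have h2 := differentiableAt_coordEndo hk i m
  have h := dFun_apply_gen_of_invariant A m (dc_invariant hA (hψ i).1 hinv i)
    (a := fun y => -(fderiv ℝ (coordFun I ψ m) y).comp (coordEndo I (hk.J i) m y))
    (h1.clm_comp h2).neg (fun y hy v => coordForm_dc (hψ i).1 (hk.J i) m v hy) hsm X
  have h3 : dFun I (fun p => (1 / 2 : ℝ) * dc I (hk.J i) ψ p (A.gen p)) m X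
      = (1 / 2 : ℝ) * dFun I (fun p => dc I (hk.J i) ψ p (A.gen p)) m X := by
    have h4 := (hsm.hasMFDerivAt.const_smul (1 / 2 : ℝ)).mfderiv
    exact congrArg (fun L : TangentSpace I m →L[ℝ] ℝ => L X) h4
  have h5 := (hψ i).2 m (A.gen m) X
  unfold ddc at h5
  unfold Hyperkahler.metric at h5
  unfold Hyperkahler.omega
  rw [h3, h, ← h5]
  ring

end PotentialMoment

section ConePotential

variable {E : Type*} [NormedAddCommGroup E] [NormedSpace ℝ E]
  {H : Type*} [TopologicalSpace H] {I : ModelWithCorners ℝ E H} [I.Boundaryless]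
  {S : Type*} [TopologicalSpace S] [ChartedSpace H S] [IsManifold I ∞ S]

/-- The function `½ρ²`. -/
def halfSqRadius (p : Cone S) : ℝ := 1 / 2 * radius p ^ 2

omit [I.Boundaryless] [IsManifold I ∞ S] in
theorem contMDiff_radius : ContMDiff (coneModel I) 𝓘(ℝ, ℝ) ∞ (radius : Cone S → ℝ) :=
  contMDiff_subtype_val.comp contMDiff_fst

omit [I.Boundaryless] [IsManifold I ∞ S] in
theorem contMDiff_halfSqRadius :
    ContMDiff (coneModel I) 𝓘(ℝ, ℝ) ∞ (halfSqRadius : Cone S → ℝ) := by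
  have h : (halfSqRadius : Cone S → ℝ) = fun p => 1 / 2 * (radius p * radius p) := by
    funext p; simp only [halfSqRadius, sq]
  rw [h]
  exact contMDiff_const.mul (contMDiff_radius.mul contMDiff_radius)

theorem posReal_chart (r q : PosReal) : extChartAt 𝓘(ℝ, ℝ) r q = (q : ℝ) := by
  simp [extChartAt, TopologicalSpace.Opens.chartAt_eq]
  rfl

omit [I.Boundaryless] [IsManifold I ∞ S] in
theorem cone_chart_symm {p : Cone S} {y : ℝ × E}
    (hy : y ∈ (extChartAt (coneModel I) p).target) :
    radius ((extChartAt (coneModel I) p).symm y) = y.1 ∧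
    ((extChartAt (coneModel I) p).symm y).2 = (extChartAt I p.2).symm y.2 ∧
    y.2 ∈ (extChartAt I p.2).target := by
  rw [extChartAt_prod] at hy ⊢
  have h1 := hy.1
  refine ⟨?_, rfl, hy.2⟩
  have h2 := (extChartAt 𝓘(ℝ, ℝ) p.1).right_inv h1
  rw [posReal_chart] at h2
  exact h2

omit [IsManifold I ∞ S] in
theorem coordFun_radius {p : Cone S} {y : ℝ × E}
    (hy : y ∈ (extChartAt (coneModel I) p).target) (v : ℝ × E) :
    fderiv ℝ (coordFun (coneModel I) radius p) y v = v.1 := by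
  have h : coordFun (coneModel I) radius p =ᶠ[nhds y] Prod.fst := by
    filter_upwards [target_mem_nhds (coneModel I) p hy] with z hz using (cone_chart_symm hz).1
  rw [h.fderiv_eq, fderiv_fst]
  rfl

theorem mfderiv_snd_chartField {p : Cone S} {y : ℝ × E}
    (hy : y ∈ (extChartAt (coneModel I) p).target) (v : ℝ × E) :
    (mfderiv (coneModel I) I Prod.snd ((extChartAt (coneModel I) p).symm y)
      (chartField (coneModel I) p v y) : E) = chartField I p.2 v.2 y.2 := by
  have : IsManifold I 1 S := .of_le (n := ∞) (by simp)
  have : IsManifold (coneModel I) 1 (Cone S) := .of_le (n := ∞) (by simp)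
  obtain ⟨-, -, hy2⟩ := cone_chart_symm hy
  have h1 := mfderiv_comp y
    (mdifferentiableAt_snd (I := 𝓘(ℝ, ℝ)) (I' := I) (x := (extChartAt (coneModel I) p).symm y))
    (mdifferentiableAt_chart_symm (coneModel I) p hy)
  have h2 := mfderiv_comp (I := 𝓘(ℝ, ℝ × E)) (I' := 𝓘(ℝ, E)) (f := (Prod.snd : ℝ × E → E)) y
    (mdifferentiableAt_chart_symm I p.2 hy2) differentiableAt_snd.mdifferentiableAt
  have h3 : (Prod.snd ∘ (extChartAt (coneModel I) p).symm) =
      ((extChartAt I p.2).symm ∘ (Prod.snd : ℝ × E → E)) := by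
    rw [extChartAt_prod]
    rfl
  rw [chartField_eq, chartField_eq]
  have h4 := congrArg (fun L : ℝ × E →L[ℝ] E => L v) h1
  have h5 := congrArg (fun L : ℝ × E →L[ℝ] E => L v) h2
  have h6 : mfderiv 𝓘(ℝ, ℝ × E) 𝓘(ℝ, E) (Prod.snd : ℝ × E → E) y = ContinuousLinearMap.snd ℝ ℝ E := by
    rw [mfderiv_eq_fderiv, fderiv_snd]
  rw [h3] at h4
  refine h4.symm.trans (h5.trans ?_)
  exact congrArg (fun L : ℝ × E →L[ℝ] E => (mfderiv 𝓘(ℝ, E) I (extChartAt I p.2).symm y.2) (L v)) h6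

theorem coordBilin_cone {gS : SmoothMetric I S} {g : SmoothMetric (coneModel I) (Cone S)}
    (hg : IsConeMetric gS g) {p : Cone S} {y : ℝ × E}
    (hy : y ∈ (extChartAt (coneModel I) p).target) (v w : ℝ × E) :
    coordBilin (coneModel I) g.inner p y v w
      = v.1 * w.1 + y.1 ^ 2 * coordBilin I gS.inner p.2 y.2 v.2 w.2 := by
  have : IsManifold (coneModel I) 1 (Cone S) := .of_le (n := ∞) (by simp)
  obtain ⟨h1, h2, hy2⟩ := cone_chart_symm hy
  have hr : ∀ v, dFun (coneModel I) radius ((extChartAt (coneModel I) p).symm y)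
      (chartField (coneModel I) p v y) = v.1 := fun v => by
    rw [dFun_chartField (coneModel I) p hy (contMDiff_radius.mdifferentiableAt (by simp)),
      coordFun_radius hy]
  have key : ∀ (q : S) (_ : q = (extChartAt I p.2).symm y.2) (u u' : TangentSpace I q),
      (u : E) = chartField I p.2 v.2 y.2 → (u' : E) = chartField I p.2 w.2 y.2 →
      gS.inner q u u' = coordBilin I gS.inner p.2 y.2 v.2 w.2 := by
    rintro q rfl u u' hu hu'
    exact congrArg₂ (fun a b => gS.inner ((extChartAt I p.2).symm y.2) a b) hu hu'
  rw [coordBilin_apply, hg, hr, hr, h1,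
    key _ h2 _ _ (mfderiv_snd_chartField hy v) (mfderiv_snd_chartField hy w)]

variable [FiniteDimensional ℝ E]

theorem isKahlerPotential_halfSqRadius {gS : SmoothMetric I S}
    {hk : Hyperkahler (coneModel I) (Cone S)} (hg : IsConeMetric gS hk.g) (i : Fin 3) :
    IsKahlerPotential (coneModel I) hk.metric (hk.J i) (halfSqRadius : Cone S → ℝ) := by
  have hsm := contMDiff_halfSqRadius (I := I) (S := S)
  refine ⟨hsm, fun p X Y => ?_⟩
  have hy0 := mem_extChartAt_target (I := coneModel I) p
  have ht := target_mem_nhds (coneModel I) p hy0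
  have h := ddc_eq_of_homothety hk i p (R := fun y => (y.1, 0)) hsm
    (by fun_prop) ?_ ?_ X Y
  · rw [h]
    unfold Hyperkahler.omega Hyperkahler.metric
    ring
  · filter_upwards [ht] with y hy v
    rw [coordBilin_cone hg hy]
    have h1 : coordFun (coneModel I) halfSqRadius p =ᶠ[nhds y] fun z => 1 / 2 * z.1 ^ 2 := by
      filter_upwards [target_mem_nhds (coneModel I) p hy] with z hz
      unfold coordFun halfSqRadius
      rw [(cone_chart_symm hz).1]
    have h2 : HasFDerivAt (fun z : ℝ × E => 1 / 2 * z.1 ^ 2) _ y :=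
      ((hasFDerivAt_fst (𝕜 := ℝ) (p := y)).pow 2).const_mul (1 / 2)
    rw [h1.fderiv_eq, h2.fderiv]
    simp
    ring
  · intro X Y
    have hy2 := (cone_chart_symm hy0).2.2
    have hR : fderiv ℝ (fun y : ℝ × E => (y.1, (0 : E))) (extChartAt (coneModel I) p p)
        = (ContinuousLinearMap.fst ℝ ℝ E).prod 0 :=
      (hasFDerivAt_fst.prodMk (hasFDerivAt_const _ _)).fderiv
    have hgd := differentiableAt_coordBilin hk p
    have h1 : ∀ Z, fderiv ℝ (coordBilin (coneModel I) hk.g.inner p)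
        (extChartAt (coneModel I) p p) Z X Y
        = fderiv ℝ (fun y => coordBilin (coneModel I) hk.g.inner p y X Y)
        (extChartAt (coneModel I) p p) Z := by
      intro Z
      have h := (hgd.hasFDerivAt.clm_apply (hasFDerivAt_const X _)).clm_apply
        (hasFDerivAt_const Y _)
      rw [h.fderiv]
      simp only [add_apply, ContinuousLinearMap.flip_apply, ContinuousLinearMap.comp_apply,
        zero_apply, map_zero, zero_add]
    have h2 : (fun y => coordBilin (coneModel I) hk.g.inner p y X Y)
        =ᶠ[nhds (extChartAt (coneModel I) p p)]
        fun y => X.1 * Y.1 + y.1 ^ 2 * coordBilin I gS.inner p.2 y.2 X.2 Y.2 := by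
      filter_upwards [ht] with y hy using coordBilin_cone hg hy X Y
    have hS : DifferentiableAt ℝ (fun z => coordBilin I gS.inner p.2 z X.2 Y.2)
        (extChartAt (coneModel I) p p).2 := by
      have h : (extChartAt (coneModel I) p p).2 = extChartAt I p.2 p.2 := by
        rw [extChartAt_prod]; rfl
      rw [h]
      exact (((contDiffAt_coordBilin I gS p.2).differentiableAt (by simp)).clm_apply
        (differentiableAt_const _)).clm_apply (differentiableAt_const _)
    have h3 := (((hasFDerivAt_fst (𝕜 := ℝ) (p := extChartAt (coneModel I) p p)).pow 2).mul
      (hS.hasFDerivAt.comp (extChartAt (coneModel I) p p) hasFDerivAt_snd)).const_add (X.1 * Y.1)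
    have h4 : fderiv ℝ (fun y : ℝ × E => X.1 * Y.1 + y.1 ^ 2 *
        coordBilin I gS.inner p.2 y.2 X.2 Y.2) (extChartAt (coneModel I) p p) = _ := h3.fderiv
    rw [h1, h2.fderiv_eq, h4, hR, coordBilin_cone hg hy0, coordBilin_cone hg hy0,
      coordBilin_cone hg hy0]
    simp
    ring

end ConePotential

section Powers

variable {E : Type*} [NormedAddCommGroup E] [NormedSpace ℝ E]
  {H : Type*} [TopologicalSpace H] {I : ModelWithCorners ℝ E H}
  {M : Type*} [TopologicalSpace M] [ChartedSpace H M]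
  {J : ∀ m : M, TangentSpace I m →L[ℝ] TangentSpace I m} {K : M → ℝ}

theorem wedge_dFun_dc_self {m : M} {X : TangentSpace I m} (hJ : J m (J m X) = -X) :
    wedge I (dFun I K) (dc I J K) m X (J m X)
      = dFun I K m X ^ 2 + dFun I K m (J m X) ^ 2 := by
  have hdc : ∀ Y : TangentSpace I m, dc I J K m Y = -dFun I K m (J m Y) := fun _ => rfl
  unfold wedge
  rw [hdc, hdc, hJ, map_neg]
  ring

theorem contMDiff_rpow (hK : ContMDiff I 𝓘(ℝ, ℝ) ∞ K) (hpos : ∀ m, 0 < K m) (α : ℝ) :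
    ContMDiff I 𝓘(ℝ, ℝ) ∞ (fun p => K p ^ α) := fun m =>
  (Real.contDiffAt_rpow_const_of_ne (hpos m).ne').contMDiffAt.comp m (hK m)

theorem dFun_rpow (hK : ContMDiff I 𝓘(ℝ, ℝ) ∞ K) (hpos : ∀ m, 0 < K m) (α : ℝ) (m : M) :
    dFun I (fun p => K p ^ α) m = (α * K m ^ (α - 1)) • dFun I K m := by
  have h1 : HasMFDerivAt I 𝓘(ℝ, ℝ) K m (dFun I K m) :=
    ((hK m).mdifferentiableAt (by simp)).hasMFDerivAt
  have h2 := (Real.hasDerivAt_rpow_const (p := α) (Or.inl (hpos m).ne')).hasFDerivAt.hasMFDerivAt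
  have h3 := (HasMFDerivAt.comp m h2 h1).mfderiv
  refine Eq.trans h3 (ContinuousLinearMap.ext fun X => ?_)
  change dFun I K m X * (α * K m ^ (α - 1)) = α * K m ^ (α - 1) * dFun I K m X
  ring

theorem ddc_rpow [I.Boundaryless] [IsManifold I ∞ M] (hK : ContMDiff I 𝓘(ℝ, ℝ) ∞ K)
    (hpos : ∀ m, 0 < K m) {m : M} (hd : FormDifferentiableAt I (dc I J K) m) (α : ℝ)
    (X Y : TangentSpace I m) :
    ddc I J (fun p => K p ^ α) m X Y = α * K m ^ (α - 1) * ddc I J K m X Y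
      + α * ((α - 1) * K m ^ (α - 2)) * wedge I (dFun I K) (dc I J K) m X Y := by
  have hs : ContMDiff I 𝓘(ℝ, ℝ) ∞ (fun p => α * K p ^ (α - 1)) :=
    contMDiff_const.mul (contMDiff_rpow hK hpos (α - 1))
  have h : dc I J (fun p => K p ^ α) = fun p => (α * K p ^ (α - 1)) • dc I J K p := by
    funext p
    unfold dc
    rw [dFun_rpow hK hpos, ContinuousLinearMap.smul_comp, smul_neg]
  have hc : ∀ Z, dFun I (fun p => α * K p ^ (α - 1)) m Z
      = α * ((α - 1) * K m ^ (α - 2)) * dFun I K m Z := by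
    intro Z
    have h1 : HasMFDerivAt I 𝓘(ℝ, ℝ) (fun p => K p ^ (α - 1)) m _ :=
      ((contMDiff_rpow hK hpos (α - 1) m).mdifferentiableAt (by simp)).hasMFDerivAt
    have h2 := congrArg (fun L : TangentSpace I m →L[ℝ] ℝ => L Z) (h1.const_smul α).mfderiv
    have h3 := congrArg (fun L : TangentSpace I m →L[ℝ] ℝ => α * L Z)
      (dFun_rpow hK hpos (α - 1) m)
    refine (h2.trans h3).trans ?_
    change α * ((α - 1) * K m ^ (α - 1 - 1) * dFun I K m Z) = _
    rw [show α - 1 - 1 = α - 2 by ring]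
    ring
  unfold ddc
  rw [h, dOne_smul I hs hd]
  simp only [wedge, hc]
  ring

end Powers

section ConeEstimates

variable {E : Type*} [NormedAddCommGroup E] [NormedSpace ℝ E]
  {H : Type*} [TopologicalSpace H] {I : ModelWithCorners ℝ E H}
  {S : Type*} [TopologicalSpace S] [ChartedSpace H S] [IsManifold I ∞ S]
  {gS : SmoothMetric I S} {hk : Hyperkahler (coneModel I) (Cone S)} {A : RAction I S}

omit [IsManifold I ∞ S] in
theorem RAction.cone_invariant_halfSqRadius (A : RAction I S) :
    A.cone.Invariant (halfSqRadius : Cone S → ℝ) := fun _ _ => rfl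

omit [IsManifold I ∞ S] in
theorem dFun_halfSqRadius (p : Cone S) (X : TangentSpace (coneModel I) p) :
    dFun (coneModel I) halfSqRadius p X = radius p * dFun (coneModel I) radius p X := by
  have hr : HasMFDerivAt (coneModel I) 𝓘(ℝ, ℝ) (radius : Cone S → ℝ) p
      (dFun (coneModel I) radius p) :=
    ((contMDiff_radius p).mdifferentiableAt (by simp)).hasMFDerivAt
  have h : (halfSqRadius : Cone S → ℝ) = (1 / 2 : ℝ) • (radius * radius) := by
    funext p; simp only [halfSqRadius, sq, Pi.smul_apply, Pi.mul_apply, smul_eq_mul]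
  have h1 := (hr.mul hr).const_smul (1 / 2 : ℝ)
  rw [← h] at h1
  refine (congrArg (fun L : TangentSpace (coneModel I) p →L[ℝ] ℝ => L X) h1.mfderiv).trans ?_
  change 1 / 2 * (radius p * dFun (coneModel I) radius p X
    + radius p * dFun (coneModel I) radius p X) = _
  ring

theorem coneMoment_eq (hk : Hyperkahler (coneModel I) (Cone S)) (A : RAction I S) :
    coneMoment hk A = fun j p =>
      (1 / 2 : ℝ) * dc (coneModel I) (hk.J j) halfSqRadius p (A.cone.gen p) := by
  funext j p
  have hr : HasMFDerivAt (coneModel I) 𝓘(ℝ, ℝ) (halfSqRadius : Cone S → ℝ) p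
      (dFun (coneModel I) halfSqRadius p) :=
    ((contMDiff_halfSqRadius p).mdifferentiableAt (by simp)).hasMFDerivAt
  have h : (fun q : Cone S => radius q ^ 2) = (2 : ℝ) • halfSqRadius := by
    funext q
    simp only [halfSqRadius, Pi.smul_apply, smul_eq_mul]
    ring
  have h1 := hr.const_smul (2 : ℝ)
  have h2 := congrArg (fun L : TangentSpace (coneModel I) p →L[ℝ] ℝ =>
    L (hk.J j p (A.cone.gen p))) h1.mfderiv
  unfold coneMoment
  rw [h]
  change (1 / 4 : ℝ) * -dFun (coneModel I) ((2 : ℝ) • halfSqRadius) p (hk.J j p (A.cone.gen p))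
    = 1 / 2 * -dFun (coneModel I) halfSqRadius p (hk.J j p (A.cone.gen p))
  have h3 : dFun (coneModel I) ((2 : ℝ) • halfSqRadius) p (hk.J j p (A.cone.gen p))
    = 2 * dFun (coneModel I) halfSqRadius p (hk.J j p (A.cone.gen p)) := h2
  rw [h3]
  ring

theorem conePotential_eq (hk : Hyperkahler (coneModel I) (Cone S)) (A : RAction I S) (a : ℝ) :
    conePotential hk A a = deformedPotential (coneMoment hk A) a 0 halfSqRadius := by
  funext p
  simp only [conePotential, deformedPotential, halfSqRadius, Fin.sum_univ_three]
  ring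

theorem conePotential_pos (hk : Hyperkahler (coneModel I) (Cone S)) (A : RAction I S) (a : ℝ)
    (p : Cone S) : 0 < conePotential hk A a p := by
  have hr : 0 < radius p := p.1.2
  unfold conePotential
  positivity

omit [IsManifold I ∞ S] in
theorem dFun_radius_gen (A : RAction I S) (p : Cone S) :
    dFun (coneModel I) radius p (A.cone.gen p) = 0 :=
  RAction.Invariant.dFun_gen (A := A.cone) (f := radius)
    (fun q => (contMDiff_radius q).mdifferentiableAt (by simp)) (fun _ _ => rfl) p

theorem dFun_radius_sq_le (hg : IsConeMetric gS hk.g) (A : RAction I S) (a : ℝ) (p : Cone S)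
    (X : TangentSpace (coneModel I) p) :
    dFun (coneModel I) radius p X ^ 2 ≤ hk.g.inner p X X
      - a ^ 2 / genNorm hk A.cone a p * hk.g.inner p (A.cone.gen p) X ^ 2 := by
  have hN := genNorm_pos hk A.cone a p
  have hN' : hk.g.inner p (A.cone.gen p) (A.cone.gen p) * a ^ 2 = genNorm hk A.cone a p - 1 := by
    unfold genNorm; ring
  have hcs := metric_cauchySchwarz gS p.2 (mfderiv (coneModel I) I Prod.snd p (A.cone.gen p))
    (mfderiv (coneModel I) I Prod.snd p X)
  have hnn : 0 ≤ gS.inner p.2 (mfderiv (coneModel I) I Prod.snd p X)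
      (mfderiv (coneModel I) I Prod.snd p X) := by
    by_cases h : mfderiv (coneModel I) I Prod.snd p X = 0
    · rw [h, map_zero]
    · exact (gS.pos p.2 _ h).le
  rw [hg, dFun_radius_gen] at hN'
  rw [hg, hg, dFun_radius_gen]
  generalize gS.inner p.2 (mfderiv (coneModel I) I Prod.snd p (A.cone.gen p))
    (mfderiv (coneModel I) I Prod.snd p X) = b at *
  generalize gS.inner p.2 (mfderiv (coneModel I) I Prod.snd p (A.cone.gen p))
    (mfderiv (coneModel I) I Prod.snd p (A.cone.gen p)) = t at *
  generalize gS.inner p.2 (mfderiv (coneModel I) I Prod.snd p X)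
    (mfderiv (coneModel I) I Prod.snd p X) = s at *
  generalize genNorm hk A.cone a p = N at *
  have h1 : a ^ 2 / N * (0 * dFun (coneModel I) radius p X + radius p ^ 2 * b) ^ 2
      ≤ radius p ^ 2 * s := by
    rw [div_mul_eq_mul_div, div_le_iff₀ hN]
    have h2 := mul_le_mul_of_nonneg_left hcs
      (mul_nonneg (sq_nonneg a) (sq_nonneg (radius p ^ 2)))
    have h3 : 0 ≤ radius p ^ 2 * s := mul_nonneg (sq_nonneg _) hnn
    have h4 : radius p ^ 2 * s * N = radius p ^ 2 * s
        + a ^ 2 * (radius p ^ 2) ^ 2 * (t * s) := by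
      linear_combination (-(radius p ^ 2 * s)) * hN'
    rw [h4]
    nlinarith
  linarith [sq (dFun (coneModel I) radius p X)]

theorem sq_add_le_mul (ρ r a x₀ x₁ x₂ d₀ d₁ d₂ : ℝ) {G : ℝ} (hG : r ^ 2 ≤ G) :
    (ρ * r + a ^ 2 * (2 * x₀ * d₀ + x₁ * d₁ + x₂ * d₂)) ^ 2
      ≤ (2 * ρ ^ 2 + a ^ 2 * (4 * x₀ ^ 2 + 2 * x₁ ^ 2 + 2 * x₂ ^ 2))
        * (G + a ^ 2 * (d₀ ^ 2 + d₁ ^ 2 + d₂ ^ 2)) :=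
  calc (ρ * r + a ^ 2 * (2 * x₀ * d₀ + x₁ * d₁ + x₂ * d₂)) ^ 2
      ≤ (ρ ^ 2 + a ^ 2 * (4 * x₀ ^ 2 + x₁ ^ 2 + x₂ ^ 2))
        * (r ^ 2 + a ^ 2 * (d₀ ^ 2 + d₁ ^ 2 + d₂ ^ 2)) :=
        le_of_sub_nonneg (le_of_le_of_eq (b := (a * (ρ * d₀ - 2 * x₀ * r)) ^ 2
          + (a * (ρ * d₁ - x₁ * r)) ^ 2 + (a * (ρ * d₂ - x₂ * r)) ^ 2
          + (a ^ 2 * (2 * x₀ * d₁ - x₁ * d₀)) ^ 2 + (a ^ 2 * (2 * x₀ * d₂ - x₂ * d₀)) ^ 2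
          + (a ^ 2 * (x₁ * d₂ - x₂ * d₁)) ^ 2) (by positivity) (by ring))
    _ ≤ _ := by
        refine mul_le_mul ?_ (by linarith) (by positivity) (by positivity)
        linarith [sq_nonneg ρ, mul_nonneg (sq_nonneg a) (sq_nonneg x₁),
          mul_nonneg (sq_nonneg a) (sq_nonneg x₂)]

theorem dFun_conePotential_sq_le (hg : IsConeMetric gS hk.g)
    (hx : IsMomentMap hk A.cone (coneMoment hk A)) (a : ℝ) (p : Cone S)
    (X : TangentSpace (coneModel I) p) :
    dFun (coneModel I) (conePotential hk A a) p X ^ 2 ≤ 4 * conePotential hk A a p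
      * deformedMetric hk A.cone (coneMoment hk A) a p X X := by
  have h1 := dFun_radius_sq_le hg A a p X
  have hd := dFun_deformedPotential (contMDiff_halfSqRadius (I := I) (S := S))
    (fun i => (hx i).1) a 0 p X
  rw [← conePotential_eq, dFun_halfSqRadius] at hd
  rw [hd, deformedMetric_apply, Fin.sum_univ_three]
  have hK : 4 * conePotential hk A a p = 2 * radius p ^ 2 + a ^ 2 *
      (4 * coneMoment hk A 0 p ^ 2 + 2 * coneMoment hk A 1 p ^ 2
        + 2 * coneMoment hk A 2 p ^ 2) := by
    unfold conePotential; ring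
  rw [hK]
  have hG : hk.g.inner p X X - a ^ 2 / genNorm hk A.cone a p
      * hk.g.inner p (A.cone.gen p) X * hk.g.inner p (A.cone.gen p) X
      = hk.g.inner p X X - a ^ 2 / genNorm hk A.cone a p
      * hk.g.inner p (A.cone.gen p) X ^ 2 := by ring
  refine (sq_add_le_mul _ _ a _ _ _ _ _ _ (h1.trans_eq hG.symm)).trans_eq ?_
  rw [show (0 + 1 : Fin 3) = 1 from rfl, show (0 + 2 : Fin 3) = 2 from rfl]
  ring

variable [I.Boundaryless] [FiniteDimensional ℝ E]

theorem isMomentMap_coneMoment (hg : IsConeMetric gS hk.g) (hA : A.cone.Preserves hk) :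
    IsMomentMap hk A.cone (coneMoment hk A) := by
  rw [coneMoment_eq]
  exact isMomentMap_of_potential hA A.cone_invariant_halfSqRadius
    (isKahlerPotential_halfSqRadius hg)

omit [I.Boundaryless] [FiniteDimensional ℝ E] in
theorem dc_halfSqRadius_gen (hk : Hyperkahler (coneModel I) (Cone S)) (A : RAction I S)
    (p : Cone S) :
    dc (coneModel I) (hk.J 0) halfSqRadius p (A.cone.gen p) = 2 * coneMoment hk A 0 p := by
  rw [coneMoment_eq]
  ring

theorem isKahlerPotential_conePotential (hg : IsConeMetric gS hk.g) (hA : A.cone.Preserves hk)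
    (a : ℝ) :
    IsKahlerPotential (coneModel I) (deformedMetric hk A.cone (coneMoment hk A) a)
      (deformedJ hk A.cone (coneMoment hk A) a 0) (conePotential hk A a) := by
  rw [conePotential_eq]
  exact isKahlerPotential_deformedPotential (isMomentMap_coneMoment hg hA)
    (isKahlerPotential_halfSqRadius hg 0) A.cone_invariant_halfSqRadius
    (dc_halfSqRadius_gen hk A) a

theorem ddc_conePotential_self (hg : IsConeMetric gS hk.g) (hA : A.cone.Preserves hk)
    (a : ℝ) (p : Cone S) (X : TangentSpace (coneModel I) p) :
    ddc (coneModel I) (deformedJ hk A.cone (coneMoment hk A) a 0) (conePotential hk A a) p X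
      (deformedJ hk A.cone (coneMoment hk A) a 0 p X)
      = 2 * deformedMetric hk A.cone (coneMoment hk A) a p X X := by
  have h := (isKahlerPotential_conePotential hg hA a).2 p X
    (deformedJ hk A.cone (coneMoment hk A) a 0 p X)
  rw [(isMomentMap_coneMoment hg hA).deformedMetric_J_J] at h
  linarith

theorem wedge_conePotential_le (hg : IsConeMetric gS hk.g) (hA : A.cone.Preserves hk)
    (a : ℝ) (p : Cone S) (X : TangentSpace (coneModel I) p) :
    wedge (coneModel I) (dFun (coneModel I) (conePotential hk A a))
      (dc (coneModel I) (deformedJ hk A.cone (coneMoment hk A) a 0) (conePotential hk A a)) p X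
      (deformedJ hk A.cone (coneMoment hk A) a 0 p X)
      ≤ 8 * conePotential hk A a p * deformedMetric hk A.cone (coneMoment hk A) a p X X := by
  have hx := isMomentMap_coneMoment hg hA
  have h1 := dFun_conePotential_sq_le hg hx a p X
  have h2 := dFun_conePotential_sq_le hg hx a p (deformedJ hk A.cone (coneMoment hk A) a 0 p X)
  rw [hx.deformedMetric_J_J] at h2
  rw [wedge_dFun_dc_self (hx.deformedJ_sq a p 0 X)]
  linarith

theorem strictlyPSH_conePotential_rpow (hg : IsConeMetric gS hk.g) (hA : A.cone.Preserves hk)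
    (a : ℝ) {α : ℝ} (hα : 3 / 4 < α) :
    StrictlyPSH (coneModel I) (deformedJ hk A.cone (coneMoment hk A) a 0)
      (fun p => conePotential hk A a p ^ α) := by
  have hx := isMomentMap_coneMoment hg hA
  have hpos := conePotential_pos hk A a
  have hs := (isKahlerPotential_conePotential hg hA a).1
  refine ⟨contMDiff_rpow hs hpos α, fun p X hX => ?_⟩
  have hd := formDifferentiableAt_dc_deformedPotential hx (contMDiff_halfSqRadius (I := I) (S := S))
    A.cone_invariant_halfSqRadius (dc_halfSqRadius_gen hk A) a p
  rw [← conePotential_eq] at hd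
  have hW := wedge_conePotential_le hg hA a p X
  have hW0 : 0 ≤ wedge (coneModel I) (dFun (coneModel I) (conePotential hk A a))
      (dc (coneModel I) (deformedJ hk A.cone (coneMoment hk A) a 0) (conePotential hk A a)) p X
      (deformedJ hk A.cone (coneMoment hk A) a 0 p X) := by
    rw [wedge_dFun_dc_self (hx.deformedJ_sq a p 0 X)]
    positivity
  have hG := deformedMetric_pos hk A.cone (coneMoment hk A) a p hX
  rw [ddc_rpow hs hpos hd, ddc_conePotential_self hg hA]
  generalize wedge (coneModel I) _ _ p X _ = W at *
  generalize deformedMetric hk A.cone (coneMoment hk A) a p X X = G at *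
  have hK := hpos p
  generalize conePotential hk A a p = k at *
  have hk1 : k ^ (α - 1) = k ^ (α - 2) * k := by
    rw [← Real.rpow_add_one hK.ne']
    ring_nf
  have hk2 : 0 < k ^ (α - 2) := Real.rpow_pos_of_pos hK _
  rw [hk1, show α * (k ^ (α - 2) * k) * (2 * G) + α * ((α - 1) * k ^ (α - 2)) * W
    = α * k ^ (α - 2) * (2 * (k * G) + (α - 1) * W) by ring]
  have hkG : 0 < k * G := mul_pos hK hG
  refine mul_pos (mul_pos (by linarith) hk2) ?_
  rcases hW0.eq_or_lt with h | h
  · rw [← h]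
    linarith
  · linarith [mul_pos (sub_pos.2 hα) h]

end ConeEstimates

end TaubNUT

end

theorem mainTheorem9 :
    -- the deformed potential on a hyperkähler manifold with a tri-Hamiltonian action
    (∀ (E : Type*) [NormedAddCommGroup E] [NormedSpace ℝ E] [FiniteDimensional ℝ E]
      (H : Type*) [TopologicalSpace H] (I : ModelWithCorners ℝ E H) [I.Boundaryless]
      (M : Type*) [TopologicalSpace M] [ChartedSpace H M] [IsManifold I ∞ M]
      [T2Space M] [SecondCountableTopology M]
      (hk : TaubNUT.Hyperkahler I M) (A : TaubNUT.RAction I M) (_ : A.Preserves hk)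
      (x : Fin 3 → M → ℝ) (_ : TaubNUT.IsMomentMap hk A x)
      (i : Fin 3) (K : M → ℝ) (_ : A.Invariant K)
      (_ : TaubNUT.IsKahlerPotential I hk.metric (hk.J i) K)
      (_ : ∀ m, TaubNUT.dc I (hk.J i) K m (A.gen m) = 2 * x i m)
      (a : ℝ) (_ : 0 < a),
      A.Invariant (TaubNUT.deformedPotential x a i K) ∧
      TaubNUT.IsKahlerPotential I (TaubNUT.deformedMetric hk A x a)
        (TaubNUT.deformedJ hk A x a i) (TaubNUT.deformedPotential x a i K) ∧
      ∀ (m : M) (X : TangentSpace I m),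
        TaubNUT.dc I (TaubNUT.deformedJ hk A x a i)
            (TaubNUT.deformedPotential x a i K) m X
          = TaubNUT.dc I (hk.J i) K m X
            + a ^ 2 * (x (i + 1) m * TaubNUT.dFun I (x (i + 2)) m X
              - x (i + 2) m * TaubNUT.dFun I (x (i + 1)) m X)) ∧
    -- the deformed potential on a hyperkähler cone
    (∀ (E : Type*) [NormedAddCommGroup E] [NormedSpace ℝ E] [FiniteDimensional ℝ E]
      (H : Type*) [TopologicalSpace H] (I : ModelWithCorners ℝ E H) [I.Boundaryless]
      (S : Type*) [TopologicalSpace S] [ChartedSpace H S] [IsManifold I ∞ S]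
      [T2Space S] [CompactSpace S]
      (gS : TaubNUT.SmoothMetric I S)
      (hk : TaubNUT.Hyperkahler (TaubNUT.coneModel I) (TaubNUT.Cone S))
      (_ : TaubNUT.IsConeMetric gS hk.g)
      (A : TaubNUT.RAction I S) (_ : A.cone.Preserves hk),
      (∀ a : ℝ, 0 < a →
        A.cone.Invariant (TaubNUT.conePotential hk A a) ∧
        TaubNUT.IsKahlerPotential (TaubNUT.coneModel I)
          (TaubNUT.deformedMetric hk A.cone (TaubNUT.coneMoment hk A) a)
          (TaubNUT.deformedJ hk A.cone (TaubNUT.coneMoment hk A) a 0)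
          (TaubNUT.conePotential hk A a)) ∧
      (∃ C : ℝ, 0 < C ∧ ∀ a : ℝ, 0 < a →
        TaubNUT.FormLE (TaubNUT.coneModel I)
          (TaubNUT.deformedJ hk A.cone (TaubNUT.coneMoment hk A) a 0)
          (TaubNUT.wedge (TaubNUT.coneModel I)
            (TaubNUT.dFun (TaubNUT.coneModel I) (TaubNUT.conePotential hk A a))
            (TaubNUT.dc (TaubNUT.coneModel I)
              (TaubNUT.deformedJ hk A.cone (TaubNUT.coneMoment hk A) a 0)
              (TaubNUT.conePotential hk A a)))
          (fun p X Y => C * TaubNUT.conePotential hk A a p *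
            TaubNUT.ddc (TaubNUT.coneModel I)
              (TaubNUT.deformedJ hk A.cone (TaubNUT.coneMoment hk A) a 0)
              (TaubNUT.conePotential hk A a) p X Y)) ∧
      (∃ α₀ : ℝ, 0 < α₀ ∧ α₀ < 1 ∧ ∀ a : ℝ, 0 < a → ∀ α : ℝ, α₀ < α →
        TaubNUT.StrictlyPSH (TaubNUT.coneModel I)
          (TaubNUT.deformedJ hk A.cone (TaubNUT.coneMoment hk A) a 0)
          (fun p => TaubNUT.conePotential hk A a p ^ α))) := by
  refine ⟨?_, ?_⟩
  · intro E _ _ _ H _ I _ M _ _ _ _ _ hk A _ x hx i K hinv hK hgen a _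
    exact ⟨TaubNUT.invariant_deformedPotential hx hinv a i,
      TaubNUT.isKahlerPotential_deformedPotential hx hK hinv hgen a,
      TaubNUT.dc_deformedPotential hx hK.1 hinv hgen a⟩
  · intro E _ _ _ H _ I _ S _ _ _ _ _ gS hk hg A hA
    refine ⟨fun a _ => ⟨?_, TaubNUT.isKahlerPotential_conePotential hg hA a⟩,
      ⟨4, by norm_num, fun a _ p X => ?_⟩,
      ⟨3 / 4, by norm_num, by norm_num, fun a _ α hα =>
        TaubNUT.strictlyPSH_conePotential_rpow hg hA a hα⟩⟩
    · rw [TaubNUT.conePotential_eq]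
      exact TaubNUT.invariant_deformedPotential (TaubNUT.isMomentMap_coneMoment hg hA)
        A.cone_invariant_halfSqRadius a 0
    · have h := TaubNUT.wedge_conePotential_le hg hA a p X
      beta_reduce
      rw [TaubNUT.ddc_conePotential_self hg hA]
      linarith
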